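/- Let $s\in(0,1)$, let $N\ge 1$ be an integer with $N>2s$, and let $\Omega\subset\mathbb R^N$ be a bounded open set. Let $f,g:\Omega\to\mathbb R$ be continuous and bounded, with $f>0$ in $\Omega$ and $g(x_0)>0$ for some $x_0\in\Omega$ ($g$ may change sign). Let $a\ge 0$, $b>0$, $\theta>1$, $2\theta<p<2^*_s=\frac{2N}{N-2s}$, and let $1<\gamma<2$ if $a\neq 0$, and $2<\gamma<2\theta$ if $a=0$. Let $$X=\{u\in H^s(\mathbb R^N): u=0 \text{ a.e. in } \mathbb R^N\setminus\Omega\},\qquad \|u\|_X=\Big(\iint_{\mathbb R^{2N}}\frac{|u(x)-u(y)|^2}{|x-y|^{N+2s}}\,dx\,dy\Big)^{1/2},$$ and $\mathcal C^+=\{u\in X:\int_\Omega g|u|^p\,dx>0\}$. For every $u\in\mathcal C^+$ the system $$\begin{aligned} a\|tu\|_X^2+b\|tu\|_X^{2\theta}-\lambda\int_\Omega f|tu|^\gamma\,dx-t^p\int_\Omega g|u|^p\,dx&=0,\\ 2a\|tu\|_X^2+2b\theta\|tu\|_X^{2\theta}-\lambda\gamma\int_\Omega f|tu|^\gamma\,dx-p\,t^p\int_\Omega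 g|u|^p\,dx&=0\end{aligned}$$ has exactly one solution $(t,\lambda)=(t_{a,b}(u),\lambda_{a,b}(u))\in(0,\infty)\times\mathbb R$. The function $\lambda_{a,b}:\mathcal C^+\to\mathbb R$ so defined has the following properties. 1. It is continuous on $\mathcal C^+$ with respect to $\|\cdot\|_X$. 2. It is $0$-homogeneous: for $u\in\mathcal C^+$ and real $c\neq0$ one has $cu\in\mathcal C^+$ and $\lambda_{a,b}(cu)=\lambda_{a,b}(u)$. 3. It is unbounded from above on $\mathcal C^+$. 4. The extremal value $\lambda^*_{a,b}=\inf_{u\in\mathcal C^+}\lambda_{a,b}(u)$ is positive, and there exists $u\in\mathcal C^+$ with $\lambda_{a,b}(u)=\lambda^*_{a,b}$. -/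

import Mathlib

open MeasureTheory
open scoped ENNReal

noncomputable section

namespace FracKirchhoff

/-- The Gagliardo energy `∬ |u(x) - u(y)|² / |x - y|^(N + 2s) dx dy` over `ℝ^N × ℝ^N`,
as an extended nonnegative number. -/
def gagliardoEnergy (N : ℕ) (s : ℝ) (u : EuclideanSpace ℝ (Fin N) → ℝ) : ℝ≥0∞ :=
  ∫⁻ x, ∫⁻ y, ENNReal.ofReal (|u x - u y| ^ 2 / ‖x - y‖ ^ ((N : ℝ) + 2 * s))

theorem gagliardoEnergy_congr {N : ℕ} {s : ℝ} {u v : EuclideanSpace ℝ (Fin N) → ℝ}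
    (h : u =ᵐ[volume] v) : gagliardoEnergy N s u = gagliardoEnergy N s v := by
  unfold gagliardoEnergy
  refine lintegral_congr_ae ?_
  filter_upwards [h] with x hx
  refine lintegral_congr_ae ?_
  filter_upwards [h] with y hy
  rw [hx, hy]

theorem gagliardoEnergy_smul {N : ℕ} {s : ℝ} (c : ℝ) (u : EuclideanSpace ℝ (Fin N) → ℝ) :
    gagliardoEnergy N s (c • u) = ENNReal.ofReal (c ^ 2) * gagliardoEnergy N s u := by
  unfold gagliardoEnergy
  rw [← lintegral_const_mul' _ _ ENNReal.ofReal_ne_top]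
  refine lintegral_congr fun x => ?_
  rw [← lintegral_const_mul' _ _ ENNReal.ofReal_ne_top]
  refine lintegral_congr fun y => ?_
  rw [← ENNReal.ofReal_mul (sq_nonneg c)]
  congr 1
  simp only [Pi.smul_apply, smul_eq_mul, sq_abs]
  ring

theorem gagliardoEnergy_add_le {N : ℕ} {s : ℝ} {u v : EuclideanSpace ℝ (Fin N) → ℝ}
    (hu : Measurable u) :
    gagliardoEnergy N s (u + v) ≤ 2 * gagliardoEnergy N s u + 2 * gagliardoEnergy N s v := by
  have hk : Measurable fun q : EuclideanSpace ℝ (Fin N) × EuclideanSpace ℝ (Fin N) =>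
      ENNReal.ofReal (|u q.1 - u q.2| ^ 2 / ‖q.1 - q.2‖ ^ ((N : ℝ) + 2 * s)) := by
    refine ENNReal.measurable_ofReal.comp ?_
    have h1 : Measurable fun q : EuclideanSpace ℝ (Fin N) × EuclideanSpace ℝ (Fin N) =>
      u q.1 - u q.2 := (hu.comp measurable_fst).sub (hu.comp measurable_snd)
    have h2 : Measurable fun q : EuclideanSpace ℝ (Fin N) × EuclideanSpace ℝ (Fin N) =>
      ‖q.1 - q.2‖ := (measurable_fst.sub measurable_snd).norm
    exact ((by simpa only [sq_abs] using h1.pow_const 2 :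
      Measurable fun q : EuclideanSpace ℝ (Fin N) × EuclideanSpace ℝ (Fin N) =>
        |u q.1 - u q.2| ^ 2)).div (h2.pow_const _)
  have h2 : (2 : ℝ≥0∞) ≠ ∞ := ENNReal.ofNat_ne_top
  unfold gagliardoEnergy
  rw [← lintegral_const_mul' _ _ h2, ← lintegral_const_mul' _ _ h2, ← lintegral_add_left]
  · refine lintegral_mono fun x => ?_
    rw [← lintegral_const_mul' _ _ h2, ← lintegral_const_mul' _ _ h2, ← lintegral_add_left]
    · refine lintegral_mono fun y => ?_
      have hd : 0 ≤ ‖x - y‖ ^ ((N : ℝ) + 2 * s) := by positivity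
      have e : ∀ r : ℝ, 2 * ENNReal.ofReal r = ENNReal.ofReal (2 * r) := fun r => by
        rw [ENNReal.ofReal_mul zero_le_two, ENNReal.ofReal_ofNat]
      simp only [Pi.add_apply, sq_abs]
      rw [e, e, ← ENNReal.ofReal_add (by positivity) (by positivity)]
      refine ENNReal.ofReal_le_ofReal ?_
      rw [← mul_div_assoc, ← mul_div_assoc, ← add_div]
      refine div_le_div_of_nonneg_right ?_ hd
      nlinarith [sq_nonneg ((u x - u y) - (v x - v y))]
    · exact (hk.comp measurable_prodMk_left).const_mul 2
  · exact hk.lintegral_prod_right'.const_mul 2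

/-- The space `X = {u ∈ H^s(ℝ^N) : u = 0 a.e. in ℝ^N \ Ω}`, where `H^s(ℝ^N)` is the space of
(classes of) functions in `L²(ℝ^N)` with finite Gagliardo energy. Its norm is `normX` below. -/
def X (N : ℕ) (s : ℝ) (Ω : Set (EuclideanSpace ℝ (Fin N))) :
    Submodule ℝ (Lp ℝ 2 (volume : Measure (EuclideanSpace ℝ (Fin N)))) where
  carrier := {u | gagliardoEnergy N s u < ∞ ∧ ∀ᵐ x, x ∉ Ω → u x = 0}
  zero_mem' := by
    refine ⟨?_, ?_⟩
    · rw [gagliardoEnergy_congr (Lp.coeFn_zero ℝ 2 volume)]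
      simp [gagliardoEnergy]
    · filter_upwards [Lp.coeFn_zero ℝ 2 (volume : Measure (EuclideanSpace ℝ (Fin N)))]
        with x hx _
      exact hx
  add_mem' := by
    rintro u v ⟨hu, hu0⟩ ⟨hv, hv0⟩
    refine ⟨?_, ?_⟩
    · rw [gagliardoEnergy_congr (Lp.coeFn_add u v)]
      exact (gagliardoEnergy_add_le (Lp.stronglyMeasurable u).measurable).trans_lt
        (ENNReal.add_lt_top.2 ⟨ENNReal.mul_lt_top (by simp) hu, ENNReal.mul_lt_top (by simp) hv⟩)
    · filter_upwards [Lp.coeFn_add u v, hu0, hv0] with x hx h1 h2 hxΩ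
      rw [hx, Pi.add_apply, h1 hxΩ, h2 hxΩ, add_zero]
  smul_mem' := by
    rintro c u ⟨hu, hu0⟩
    refine ⟨?_, ?_⟩
    · rw [gagliardoEnergy_congr (Lp.coeFn_smul c u), gagliardoEnergy_smul]
      exact ENNReal.mul_lt_top ENNReal.ofReal_lt_top hu
    · filter_upwards [Lp.coeFn_smul c u, hu0] with x hx h1 hxΩ
      rw [hx, Pi.smul_apply, h1 hxΩ, smul_zero]

variable {N : ℕ} {s : ℝ} {Ω : Set (EuclideanSpace ℝ (Fin N))}

/-- The norm of `X`: the square root of the Gagliardo energy (finite on `X`). This, and not the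
`L²` norm inherited from the ambient space, is the norm of `X`. -/
def normX (u : X N s Ω) : ℝ := Real.sqrt (gagliardoEnergy N s (u : Lp ℝ 2 volume)).toReal

/-- `∫_Ω w |u|^q dx` for a weight `w`. -/
def weightedInt (w : EuclideanSpace ℝ (Fin N) → ℝ) (q : ℝ) (u : X N s Ω) : ℝ :=
  ∫ x in Ω, w x * |(u : Lp ℝ 2 volume) x| ^ q

/-- `C⁺ = {u ∈ X : ∫_Ω g |u|^p dx > 0}`. -/
def Cplus (N : ℕ) (s : ℝ) (Ω : Set (EuclideanSpace ℝ (Fin N)))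
    (g : EuclideanSpace ℝ (Fin N) → ℝ) (p : ℝ) : Set (X N s Ω) :=
  {u | 0 < weightedInt g p u}

/-- `(t, l)`, with `t > 0`, solves the system
`a‖tu‖² + b‖tu‖^(2θ) - l ∫ f|tu|^γ - t^p ∫ g|u|^p = 0`,
`2a‖tu‖² + 2bθ‖tu‖^(2θ) - lγ ∫ f|tu|^γ - p t^p ∫ g|u|^p = 0`. -/
def SolvesSystem (f g : EuclideanSpace ℝ (Fin N) → ℝ) (a b θ γ p : ℝ) (u : X N s Ω)
    (t l : ℝ) : Prop :=
  0 < t ∧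
  a * normX (t • u) ^ 2 + b * normX (t • u) ^ (2 * θ)
    - l * weightedInt f γ (t • u) - t ^ p * weightedInt g p u = 0 ∧
  2 * a * normX (t • u) ^ 2 + 2 * b * θ * normX (t • u) ^ (2 * θ)
    - l * γ * weightedInt f γ (t • u) - p * t ^ p * weightedInt g p u = 0

open Classical in
/-- The quotient `λ_{a,b}(u)`: the second component of the solution `(t, l)` of the system
(and `0` if there is no solution). -/
def lambdaAB (f g : EuclideanSpace ℝ (Fin N) → ℝ) (a b θ γ p : ℝ) (u : X N s Ω) : ℝ :=
  if h : ∃ q : ℝ × ℝ, SolvesSystem f g a b θ γ p u q.1 q.2 then h.choose.2 else 0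

/-- The extremal value `λ*_{a,b}`, the infimum of `λ_{a,b}` over `C⁺`. -/
def lambdaStar (N : ℕ) (s : ℝ) (Ω : Set (EuclideanSpace ℝ (Fin N)))
    (f g : EuclideanSpace ℝ (Fin N) → ℝ) (a b θ γ p : ℝ) : ℝ :=
  sInf (lambdaAB f g a b θ γ p '' Cplus N s Ω g p)

end FracKirchhoff

end

/-! Fix `u` in the cone and write A = a‖u‖², B = b‖u‖^(2θ), F = ∫ f|u|^γ, G = ∫ g|u|^p. The first
equation gives l as the quotient Q(t) = (A t^(2-γ) + B t^(2θ-γ) - G t^(p-γ))/F, and the second then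
says Q'(t) = 0. After division by a power of t, this reads `fiberSlope` = (p-γ)G, where the left
side decreases strictly from ∞ to 0. So there is one critical point, and it is a global maximum:
λ(u) = max Q over t > 0.

Everything else uses this maximum. It depends continuously on A, B, F, G, which are continuous for
the norm of X by the Sobolev embedding. Replacing `u` by cu only rescales t. For unit vectors
concentrating at a point where g > 0, compactness makes F and G tend to 0, while Q(1)F ≥ b - G;
hence λ is unbounded above.

For the infimum m, homogeneity allows a minimizing sequence of unit vectors. Compactness gives a
limit v with ‖v‖ ≤ 1 along which F and G converge. The inequalities Q(τ)F ≤ λ(u_n)F at each fixed τ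
pass to the limit, so the maximum points need not be followed. If G(v) were 0, the limiting left
side would be unbounded in τ. Hence v lies in the cone, and ‖v‖ ≤ 1 only lowers A and B, so λ(v) ≤
m. Positivity of m follows since m = λ(v) is a critical value of a fiber quotient.

The analytic input is proved directly: the fractional Sobolev inequality by estimates on level sets
and truncation, compactness in L² by step functions on small cubes, compactness in L^p by
interpolation, and finite energy of tent functions by integration in polar coordinates. -/

namespace FracKirchhoff

open Filter Topology

/-! ### The scalar fiber problem -/

/-- The function of `t` whose maximum is the value of the nonlinear Rayleigh quotient. -/
noncomputable def fiberQuotient (A B F G θ γ p t : ℝ) : ℝ :=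
  (A * t ^ (2 - γ) + B * t ^ (2 * θ - γ) - G * t ^ (p - γ)) / F

/-- The decreasing function of `t` whose level `(p - γ) * G` is the maximum point of
`fiberQuotient`. -/
noncomputable def fiberSlope (A B θ γ p t : ℝ) : ℝ :=
  (2 - γ) * A * t ^ (2 - p) + (2 * θ - γ) * B * t ^ (2 * θ - p)

/-- Subtracting γ times the first equation from the second eliminates l and leaves the slope
condition times t^p; the first equation alone then determines l. -/
theorem scalar_system_iff {A B F G θ γ p t l : ℝ} (hF : 0 < F) (ht : 0 < t) :
    (A * t ^ 2 + B * t ^ (2 * θ) - l * (t ^ γ * F) - t ^ p * G = 0 ∧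
      2 * A * t ^ 2 + 2 * B * θ * t ^ (2 * θ) - l * γ * (t ^ γ * F) - p * t ^ p * G = 0) ↔
    fiberSlope A B θ γ p t = (p - γ) * G ∧ l = fiberQuotient A B F G θ γ p t := by
  have htp : 0 < t ^ p := Real.rpow_pos_of_pos ht p
  have htγ : 0 < t ^ γ := Real.rpow_pos_of_pos ht γ
  have e0 : t ^ (2 : ℝ) = t ^ 2 := Real.rpow_two t
  have e1 : fiberSlope A B θ γ p t = (p - γ) * G ↔
      (2 - γ) * A * t ^ 2 + (2 * θ - γ) * B * t ^ (2 * θ) = (p - γ) * G * t ^ p := by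
    unfold fiberSlope
    rw [Real.rpow_sub ht, Real.rpow_sub ht, e0]
    field_simp
  have e2 : l = fiberQuotient A B F G θ γ p t ↔
      l * (t ^ γ * F) = A * t ^ 2 + B * t ^ (2 * θ) - G * t ^ p := by
    unfold fiberQuotient
    rw [Real.rpow_sub ht, Real.rpow_sub ht, Real.rpow_sub ht, e0]
    field_simp
  rw [e1, e2]
  constructor
  · rintro ⟨h1, h2⟩
    constructor
    · linear_combination h2 - γ * h1
    · linear_combination -h1
  · rintro ⟨h1, h2⟩
    constructor
    · linear_combination -h2
    · linear_combination h1 - γ * h2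

section

variable {A B F G θ γ p : ℝ}

/-- Both exponents of t are negative. Assuming the sign of the product (2-γ)A covers both regimes at
once: γ < 2, or A = 0 with γ possibly above 2. -/
theorem fiberSlope_strictAntiOn (hA : 0 ≤ (2 - γ) * A) (hB : 0 < B) (hθ : 1 < θ)
    (hγθ : γ < 2 * θ) (hp : 2 * θ < p) :
    StrictAntiOn (fiberSlope A B θ γ p) (Set.Ioi 0) := by
  intro x hx y hy hxy
  have hx' : (0 : ℝ) < x := hx
  have h1 : y ^ (2 - p) ≤ x ^ (2 - p) :=
    Real.rpow_le_rpow_of_nonpos hx' hxy.le (by linarith)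
  have h2 : y ^ (2 * θ - p) < x ^ (2 * θ - p) :=
    Real.rpow_lt_rpow_of_neg hx' hxy (by linarith)
  have hc : 0 < (2 * θ - γ) * B := mul_pos (by linarith) hB
  exact add_lt_add_of_le_of_lt (mul_le_mul_of_nonneg_left h1 hA) (mul_lt_mul_of_pos_left h2 hc)

/-- In the variable σ = 1/t all exponents are positive, so the function extends continuously by 0 at
σ = 0 and the intermediate value theorem applies on a closed interval. -/
theorem exists_fiberSlope_eq (hA : 0 ≤ (2 - γ) * A) (hB : 0 < B) (hθ : 1 < θ)
    (hγθ : γ < 2 * θ) (hp : 2 * θ < p) {K : ℝ} (hK : 0 < K) :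
    ∃ t, 0 < t ∧ fiberSlope A B θ γ p t = K := by
  have hc : 0 < (2 * θ - γ) * B := mul_pos (by linarith) hB
  set k : ℝ → ℝ := fun σ => (2 - γ) * A * σ ^ (p - 2) + (2 * θ - γ) * B * σ ^ (p - 2 * θ)
  have hk0 : k 0 = 0 := by
    simp only [k]
    rw [Real.zero_rpow (by linarith), Real.zero_rpow (by linarith)]
    ring
  have hcont : Continuous k :=
    (continuous_const.mul (Real.continuous_rpow_const (by linarith))).add
      (continuous_const.mul (Real.continuous_rpow_const (by linarith)))
  -- At this σ the B-term alone already equals K.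
  set M : ℝ := (K / ((2 * θ - γ) * B)) ^ (1 / (p - 2 * θ))
  have hM : 0 ≤ M := by positivity
  have hkM : K ≤ k M := by
    have h1 : M ^ (p - 2 * θ) = K / ((2 * θ - γ) * B) := by
      simp only [M]
      rw [← Real.rpow_mul (by positivity), one_div_mul_cancel (by linarith), Real.rpow_one]
    simp only [k]
    rw [h1, mul_div_cancel₀ _ hc.ne']
    have : 0 ≤ (2 - γ) * A * M ^ (p - 2) := mul_nonneg hA (by positivity)
    linarith
  obtain ⟨σ, ⟨hσ0, -⟩, hσ⟩ := intermediate_value_Icc hM hcont.continuousOn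
    ⟨hk0.le.trans hK.le, hkM⟩
  have hσ1 : 0 < σ := by
    refine lt_of_le_of_ne hσ0 fun h => ?_
    rw [← h, hk0] at hσ
    exact hK.ne hσ
  refine ⟨σ⁻¹, inv_pos.2 hσ1, ?_⟩
  rw [← hσ]
  simp only [fiberSlope, k]
  rw [Real.inv_rpow hσ0, Real.inv_rpow hσ0, ← Real.rpow_neg hσ0, ← Real.rpow_neg hσ0, neg_sub,
    neg_sub]

/-- Multiplying by t^(p-γ) expresses criticality through the three summands of the numerator of the
quotient, the form used in the estimates below. -/
theorem fiberSlope_eq_iff {t : ℝ} (ht : 0 < t) :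
    fiberSlope A B θ γ p t = (p - γ) * G ↔
      (2 - γ) * (A * t ^ (2 - γ)) + (2 * θ - γ) * (B * t ^ (2 * θ - γ)) =
        (p - γ) * (G * t ^ (p - γ)) := by
  have h := Real.rpow_pos_of_pos ht (p - γ)
  have e1 : t ^ (2 - γ) = t ^ (2 - p) * t ^ (p - γ) := by
    rw [← Real.rpow_add ht]; congr 1; ring
  have e2 : t ^ (2 * θ - γ) = t ^ (2 * θ - p) * t ^ (p - γ) := by
    rw [← Real.rpow_add ht]; congr 1; ring
  unfold fiberSlope
  rw [e1, e2]
  constructor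
  · intro h1
    linear_combination t ^ (p - γ) * h1
  · intro h1
    refine mul_right_cancel₀ h.ne' ?_
    linear_combination h1

/-- A critical point of the fiber quotient is a global maximum. -/
theorem fiberQuotient_le (hA0 : 0 ≤ A) (hA : A = 0 ∨ γ < 2) (hB : 0 < B) (hF : 0 < F)
    (hθ : 1 < θ) (hγθ : γ < 2 * θ) (hp : 2 * θ < p) {t τ : ℝ} (ht : 0 < t)
    (hτ : 0 < τ) (h : fiberSlope A B θ γ p t = (p - γ) * G) :
    fiberQuotient A B F G θ γ p τ ≤ fiberQuotient A B F G θ γ p t := by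
  rw [fiberSlope_eq_iff ht] at h
  have hk : 0 < p - γ := by linarith
  set x := τ / t
  have hx : 0 < x := div_pos hτ ht
  set y := x ^ (p - γ)
  have hy : 0 < y := Real.rpow_pos_of_pos hx _
  have hτx : τ = t * x := by simp only [x]; field_simp
  have hpow : ∀ c : ℝ, τ ^ c = t ^ c * x ^ c := fun c => by
    rw [hτx, Real.mul_rpow ht.le hx.le]
  -- In the variable y = x^(p-γ) the powers in the numerator become y^e with 0 ≤ e ≤ 1, which lie
  -- below their tangents at y = 1 (Bernoulli). The critical point equation says that the tangents
  -- add up to the G-term.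
  have bern : ∀ c : ℝ, 0 ≤ c → c ≤ p - γ → x ^ c - 1 ≤ c / (p - γ) * (y - 1) := by
    intro c hc0 hc1
    have h1 := rpow_one_add_le_one_add_mul_self (s := y - 1) (by linarith) (p := c / (p - γ))
      (by positivity) ((div_le_one hk).2 hc1)
    have h2 : (1 + (y - 1)) ^ (c / (p - γ)) = x ^ c := by
      rw [add_sub_cancel, ← Real.rpow_mul hx.le, mul_div_cancel₀ _ hk.ne']
    linarith
  unfold fiberQuotient
  refine div_le_div_of_nonneg_right ?_ hF.le
  rw [hpow, hpow, hpow]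
  set c1 := A * t ^ (2 - γ)
  set c2 := B * t ^ (2 * θ - γ)
  set c3 := G * t ^ (p - γ)
  have hc2 : 0 ≤ c2 := by positivity
  have hc1 : 0 ≤ c1 := by positivity
  have b1 : c1 * (x ^ (2 - γ) - 1) ≤ c1 * ((2 - γ) / (p - γ) * (y - 1)) := by
    rcases hA with hA | hA
    · simp [c1, hA]
    · exact mul_le_mul_of_nonneg_left (bern _ (by linarith) (by linarith)) hc1
  have b2 : c2 * (x ^ (2 * θ - γ) - 1) ≤ c2 * ((2 * θ - γ) / (p - γ) * (y - 1)) :=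
    mul_le_mul_of_nonneg_left (bern _ (by linarith) (by linarith)) hc2
  have h3 : c1 * ((2 - γ) / (p - γ) * (y - 1)) + c2 * ((2 * θ - γ) / (p - γ) * (y - 1))
      = c3 * (y - 1) := by
    field_simp
    linear_combination (y - 1) * h
  have e1 : A * (t ^ (2 - γ) * x ^ (2 - γ)) = c1 * x ^ (2 - γ) := by simp only [c1]; ring
  have e2 : B * (t ^ (2 * θ - γ) * x ^ (2 * θ - γ)) = c2 * x ^ (2 * θ - γ) := by
    simp only [c2]; ring
  have e3 : G * (t ^ (p - γ) * x ^ (p - γ)) = c3 * y := by simp only [c3, y]; ring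
  rw [e1, e2, e3]
  linarith

/-- At a critical point the G-term can be eliminated, which turns (p-γ) times the numerator into
(p-2)c1 + (p-2θ)c2. -/
theorem fiberQuotient_pos (hA0 : 0 ≤ A) (hB : 0 < B) (hF : 0 < F)
    (hθ : 1 < θ) (hγθ : γ < 2 * θ) (hp : 2 * θ < p) {t : ℝ} (ht : 0 < t)
    (h : fiberSlope A B θ γ p t = (p - γ) * G) :
    0 < fiberQuotient A B F G θ γ p t := by
  rw [fiberSlope_eq_iff ht] at h
  have hk : 0 < p - γ := by linarith
  unfold fiberQuotient
  refine div_pos ?_ hF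
  set c1 := A * t ^ (2 - γ)
  set c2 := B * t ^ (2 * θ - γ)
  set c3 := G * t ^ (p - γ)
  have hc2 : 0 < c2 := mul_pos hB (Real.rpow_pos_of_pos ht _)
  have hc1 : 0 ≤ c1 := by positivity
  have : 0 < (p - γ) * (c1 + c2 - c3) := by
    have e : (p - γ) * (c1 + c2 - c3) = (p - 2) * c1 + (p - 2 * θ) * c2 := by
      linear_combination h
    rw [e]
    have h1 : 0 ≤ (p - 2) * c1 := mul_nonneg (by linarith) hc1
    have h2 : 0 < (p - 2 * θ) * c2 := mul_pos (by linarith) hc2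
    linarith
  exact pos_of_mul_pos_right this hk.le

/-- The maximum of the fiber quotient depends continuously on its coefficients. -/
theorem tendsto_fiberQuotient_of_fiberSlope_eq {ι : Type*} {l : Filter ι} {Ai Bi Fi Gi ti : ι → ℝ}
    (hA : 0 ≤ (2 - γ) * A) (hB : 0 < B) (hF : 0 < F) (hθ : 1 < θ)
    (hγθ : γ < 2 * θ) (hp : 2 * θ < p)
    (hAi : Tendsto Ai l (𝓝 A)) (hBi : Tendsto Bi l (𝓝 B)) (hFi : Tendsto Fi l (𝓝 F))
    (hGi : Tendsto Gi l (𝓝 G)) (hAi0 : ∀ᶠ i in l, 0 ≤ (2 - γ) * Ai i)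
    {t : ℝ} (ht : 0 < t) (hti0 : ∀ᶠ i in l, 0 < ti i)
    (h : fiberSlope A B θ γ p t = (p - γ) * G)
    (hi : ∀ᶠ i in l, fiberSlope (Ai i) (Bi i) θ γ p (ti i) = (p - γ) * Gi i) :
    Tendsto (fun i => fiberQuotient (Ai i) (Bi i) (Fi i) (Gi i) θ γ p (ti i)) l
      (𝓝 (fiberQuotient A B F G θ γ p t)) := by
  have hslope : ∀ τ, Tendsto (fun i => fiberSlope (Ai i) (Bi i) θ γ p τ - (p - γ) * Gi i) l
      (𝓝 (fiberSlope A B θ γ p τ - (p - γ) * G)) := fun τ =>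
    ((((hAi.const_mul _).mul_const _).add ((hBi.const_mul _).mul_const _))).sub (hGi.const_mul _)
  have hBi0 : ∀ᶠ i in l, 0 < Bi i := hBi.eventually_const_lt hB
  have hanti := fiberSlope_strictAntiOn hA hB hθ hγθ hp
  -- Convergence of the maximum points by monotonicity alone: at a fixed c ≠ t the limiting slope
  -- lies strictly on one side of its level, so the perturbed slopes do too, which places `ti` on
  -- the correct side of c.
  have hT : Tendsto ti l (𝓝 t) := by
    rw [tendsto_order]
    constructor
    · intro c hc
      rcases le_or_gt c 0 with hc0 | hc0
      · filter_upwards [hti0] with i hi0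
        exact hc0.trans_lt hi0
      · have h1 : 0 < fiberSlope A B θ γ p c - (p - γ) * G := by
          rw [← h]; exact sub_pos.2 (hanti hc0 ht hc)
        filter_upwards [(hslope c).eventually_const_lt h1, hti0, hi, hBi0, hAi0]
          with i h1 h2 h3 h4 h5
        by_contra! hle
        have := (fiberSlope_strictAntiOn h5 h4 hθ hγθ hp).antitoneOn h2 hc0 hle
        linarith
    · intro c hc
      have hc0 : 0 < c := ht.trans hc
      have h1 : fiberSlope A B θ γ p c - (p - γ) * G < 0 := by
        rw [← h]; exact sub_neg.2 (hanti ht hc0 hc)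
      filter_upwards [(hslope c).eventually_lt_const h1, hti0, hi, hBi0, hAi0]
        with i h1 h2 h3 h4 h5
      by_contra! hle
      have := (fiberSlope_strictAntiOn h5 h4 hθ hγθ hp).antitoneOn hc0 h2 hle
      linarith
  have hrp : ∀ c : ℝ, Tendsto (fun i => ti i ^ c) l (𝓝 (t ^ c)) := fun c =>
    hT.rpow_const (Or.inl ht.ne')
  exact (((hAi.mul (hrp _)).add (hBi.mul (hrp _))).sub (hGi.mul (hrp _))).div hFi hF.ne'

end

/-! ### The Gagliardo energy and the fractional Sobolev inequality -/

section Gagliardo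

variable {N : ℕ} {s : ℝ}

/-- The difference quotient whose square is the integrand of the Gagliardo energy. -/
noncomputable def diffQuot (N : ℕ) (s : ℝ) (u : EuclideanSpace ℝ (Fin N) → ℝ)
    (q : EuclideanSpace ℝ (Fin N) × EuclideanSpace ℝ (Fin N)) : ℝ :=
  (u q.1 - u q.2) / ‖q.1 - q.2‖ ^ (((N : ℝ) + 2 * s) / 2)

theorem measurable_diffQuot {u : EuclideanSpace ℝ (Fin N) → ℝ} (hu : Measurable u) :
    Measurable (diffQuot N s u) := by
  unfold diffQuot
  have h2 : Measurable fun q : EuclideanSpace ℝ (Fin N) × EuclideanSpace ℝ (Fin N) =>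
    ‖q.1 - q.2‖ := (measurable_fst.sub measurable_snd).norm
  exact ((hu.comp measurable_fst).sub (hu.comp measurable_snd)).div (h2.pow_const _)

theorem enorm_diffQuot_sq (u : EuclideanSpace ℝ (Fin N) → ℝ) (x y : EuclideanSpace ℝ (Fin N)) :
    ‖diffQuot N s u (x, y)‖ₑ ^ (2 : ℝ) =
      ENNReal.ofReal (|u x - u y| ^ 2 / ‖x - y‖ ^ ((N : ℝ) + 2 * s)) := by
  have h : 0 ≤ ‖x - y‖ := norm_nonneg _
  rw [Real.enorm_eq_ofReal_abs, ENNReal.ofReal_rpow_of_nonneg (abs_nonneg _) zero_le_two]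
  congr 1
  rw [Real.rpow_two]
  unfold diffQuot
  rw [abs_div, div_pow, abs_of_nonneg (Real.rpow_nonneg h _), ← Real.rpow_two,
    ← Real.rpow_two, ← Real.rpow_mul h, div_mul_cancel₀ _ two_ne_zero]

theorem measurable_gagliardo_integrand {u : EuclideanSpace ℝ (Fin N) → ℝ} (hu : Measurable u) :
    Measurable fun q : EuclideanSpace ℝ (Fin N) × EuclideanSpace ℝ (Fin N) =>
      ENNReal.ofReal (|u q.1 - u q.2| ^ 2 / ‖q.1 - q.2‖ ^ ((N : ℝ) + 2 * s)) := by
  have := (measurable_diffQuot (s := s) hu).enorm.pow_const (2 : ℝ)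
  exact (funext fun q => enorm_diffQuot_sq u q.1 q.2 :
    (fun q => ‖diffQuot N s u q‖ₑ ^ (2 : ℝ)) = _) ▸ this

/-- Seeing the root of the energy as an L² norm on the product space makes Minkowski's inequality
available. -/
theorem eLpNorm_diffQuot {u : EuclideanSpace ℝ (Fin N) → ℝ} (hu : Measurable u) :
    eLpNorm (diffQuot N s u) 2 (volume.prod volume) = gagliardoEnergy N s u ^ (1 / 2 : ℝ) := by
  rw [eLpNorm_eq_lintegral_rpow_enorm_toReal two_ne_zero ENNReal.ofNat_ne_top]
  simp only [ENNReal.toReal_ofNat]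
  rw [lintegral_prod _ ((measurable_diffQuot hu).enorm.pow_const _).aemeasurable]
  simp only [enorm_diffQuot_sq]
  rfl

theorem gagliardoEnergy_mono {u v : EuclideanSpace ℝ (Fin N) → ℝ}
    (h : ∀ x y, |u x - u y| ≤ |v x - v y|) :
    gagliardoEnergy N s u ≤ gagliardoEnergy N s v := by
  refine lintegral_mono fun x => lintegral_mono fun y => ENNReal.ofReal_le_ofReal ?_
  have := h x y
  gcongr

theorem sqrt_gagliardoEnergy_add_le {u v : EuclideanSpace ℝ (Fin N) → ℝ} (hu : Measurable u)
    (hv : Measurable v) :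
    gagliardoEnergy N s (u + v) ^ (1 / 2 : ℝ) ≤
      gagliardoEnergy N s u ^ (1 / 2 : ℝ) + gagliardoEnergy N s v ^ (1 / 2 : ℝ) := by
  rw [← eLpNorm_diffQuot hu, ← eLpNorm_diffQuot hv, ← eLpNorm_diffQuot (hu.add hv)]
  have h : diffQuot N s (u + v) = diffQuot N s u + diffQuot N s v := by
    ext q
    simp only [diffQuot, Pi.add_apply]
    ring
  rw [h]
  exact eLpNorm_add_le (measurable_diffQuot hu).aestronglyMeasurable
    (measurable_diffQuot hv).aestronglyMeasurable one_le_two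

/-- The critical exponent `2N / (N - 2s)`. -/
noncomputable def critExp (N : ℕ) (s : ℝ) : ℝ := 2 * (N : ℝ) / ((N : ℝ) - 2 * s)

theorem two_lt_critExp (hs0 : 0 < s) (hN : 2 * s < (N : ℝ)) : 2 < critExp N s := by
  unfold critExp
  rw [lt_div_iff₀ (by linarith)]
  linarith

theorem volume_unitBall_pos :
    0 < (volume (Metric.ball (0 : EuclideanSpace ℝ (Fin N)) 1)).toReal :=
  ENNReal.toReal_pos (Metric.measure_ball_pos _ _ one_pos).ne' measure_ball_lt_top.ne

/-- The pointwise inequality behind the Sobolev inequality: if `J` bounds `∫ |v|^q` for the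
critical exponent `q`, then `|v(x)|^q` is at most a constant times
`J^(2s/N) ∫ |v(x) - v(y)|² / |x - y|^(N + 2s) dy`. -/
theorem exists_rpow_le_lintegral_diff (hs0 : 0 < s) (hN : 2 * s < (N : ℝ)) :
    ∃ c : ℝ, 0 < c ∧ ∀ v : EuclideanSpace ℝ (Fin N) → ℝ, Measurable v → ∀ J : ℝ, 0 < J →
      ∫⁻ y, ‖v y‖ₑ ^ critExp N s ≤ ENNReal.ofReal J → ∀ x,
        ENNReal.ofReal (c * |v x| ^ critExp N s * J ^ (-(2 * s / (N : ℝ)))) ≤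
          ∫⁻ y, ENNReal.ofReal (|v x - v y| ^ 2 / ‖x - y‖ ^ ((N : ℝ) + 2 * s)) := by
  have hN0 : (0 : ℝ) < N := by linarith
  have hNn : N ≠ 0 := fun h => by simp [h] at hN0
  have : Nonempty (Fin N) := ⟨⟨0, Nat.pos_of_ne_zero hNn⟩⟩
  have : Nontrivial (EuclideanSpace ℝ (Fin N)) := inferInstance
  have hNs : 0 < (N : ℝ) - 2 * s := by linarith
  set q := critExp N s with hq
  have hq2 : 2 < q := two_lt_critExp hs0 hN
  -- The factor τ² from the difference and the power of τ hidden in m^(-2s/N) combine to τ^q.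
  have hqe : 2 + q * (2 * s / N) = q := by
    rw [hq]; unfold critExp; field_simp; ring
  set κ : ℝ := (volume (Metric.ball (0 : EuclideanSpace ℝ (Fin N)) 1)).toReal with hκdef
  have hκ : 0 < κ := volume_unitBall_pos
  refine ⟨1 / 4 * (κ / 2) ^ (1 + 2 * s / N) * 2 ^ (-(q * (2 * s / N))), by positivity, ?_⟩
  intro v hv J hJ hvJ x
  rcases eq_or_ne (v x) 0 with hx | hx
  · rw [hx, abs_zero, Real.zero_rpow (by linarith)]
    simp
  set τ := |v x| with hτdef
  have hτ : 0 < τ := abs_pos.2 hx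
  set m : ℝ := (2 / τ) ^ q * J with hm
  have hm0 : 0 < m := by positivity
  -- By Chebyshev, |v| ≥ τ/2 only on a set of measure at most m; elsewhere |v x - v y| ≥ τ/2.
  set S : Set (EuclideanSpace ℝ (Fin N)) := {y | ENNReal.ofReal ((τ / 2) ^ q) ≤ ‖v y‖ₑ ^ q}
  have hSm : MeasurableSet S := measurableSet_le measurable_const (hv.enorm.pow_const _)
  have hS : volume S ≤ ENNReal.ofReal m := by
    have h1 := mul_meas_ge_le_lintegral₀ (μ := volume) (f := fun y => ‖v y‖ₑ ^ q)
      (hv.enorm.pow_const _).aemeasurable (ENNReal.ofReal ((τ / 2) ^ q))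
    have h2 := h1.trans hvJ
    have hp : 0 < (τ / 2) ^ q := by positivity
    have h3 : m = J / (τ / 2) ^ q := by
      rw [hm, Real.div_rpow zero_le_two hτ.le, Real.div_rpow hτ.le zero_le_two]
      field_simp
    rw [h3, ENNReal.ofReal_div_of_pos hp, ENNReal.le_div_iff_mul_le (Or.inl (by simpa using hp))
      (Or.inl ENNReal.ofReal_ne_top), mul_comm]
    exact h2
  -- The ball of this radius has measure 2m, so at least m of it lies outside `S`.
  set r : ℝ := (2 * m / κ) ^ (1 / (N : ℝ)) with hr
  have hr0 : 0 < r := by positivity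
  have hrN : r ^ N = 2 * m / κ := by
    rw [hr, ← Real.rpow_natCast, ← Real.rpow_mul (by positivity), one_div_mul_cancel hN0.ne',
      Real.rpow_one]
  have hB : volume (Metric.ball x r) = ENNReal.ofReal (2 * m) := by
    rw [Measure.addHaar_ball _ _ hr0.le, finrank_euclideanSpace_fin, hrN,
      ← ENNReal.ofReal_toReal (measure_ball_lt_top (μ := volume)
        (x := (0 : EuclideanSpace ℝ (Fin N))) (r := 1)).ne, ← hκdef,
      ← ENNReal.ofReal_mul (by positivity), div_mul_cancel₀ _ hκ.ne']
  have hD : ENNReal.ofReal m ≤ volume (Metric.ball x r \ S) := by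
    refine le_trans ?_ (le_measure_sdiff (μ := volume))
    rw [hB]
    refine le_trans ?_ (tsub_le_tsub_left hS _)
    rw [← ENNReal.ofReal_sub _ hm0.le]
    exact ENNReal.ofReal_le_ofReal (by linarith)
  have hpt : ∀ y ∈ Metric.ball x r \ S, ENNReal.ofReal ((τ / 2) ^ 2 / r ^ ((N : ℝ) + 2 * s)) ≤
      ENNReal.ofReal (|v x - v y| ^ 2 / ‖x - y‖ ^ ((N : ℝ) + 2 * s)) := by
    rintro y ⟨hyB, hyS⟩
    refine ENNReal.ofReal_le_ofReal ?_
    have hvy : |v y| < τ / 2 := by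
      simp only [S, Set.mem_ofPred_eq, not_le] at hyS
      rw [Real.enorm_eq_ofReal_abs, ENNReal.ofReal_rpow_of_nonneg (abs_nonneg _) (by linarith),
        ENNReal.ofReal_lt_ofReal_iff (by positivity)] at hyS
      exact (Real.rpow_lt_rpow_iff (abs_nonneg _) (by positivity) (by linarith)).1 hyS
    have hd : τ / 2 ≤ |v x - v y| := by
      have := abs_sub_abs_le_abs_sub (v x) (v y)
      linarith
    have hxy : 0 < ‖x - y‖ := by
      rw [norm_pos_iff, sub_ne_zero]
      rintro rfl
      linarith
    have hxr : ‖x - y‖ ≤ r := by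
      rw [← dist_eq_norm, dist_comm]; exact (Metric.mem_ball.1 hyB).le
    have : 0 < ‖x - y‖ ^ ((N : ℝ) + 2 * s) := Real.rpow_pos_of_pos hxy _
    gcongr
  calc _ = ENNReal.ofReal ((τ / 2) ^ 2 / r ^ ((N : ℝ) + 2 * s)) * ENNReal.ofReal m := ?_
    _ ≤ ENNReal.ofReal ((τ / 2) ^ 2 / r ^ ((N : ℝ) + 2 * s)) * volume (Metric.ball x r \ S) := by
      gcongr
    _ = ∫⁻ _y in Metric.ball x r \ S, ENNReal.ofReal ((τ / 2) ^ 2 / r ^ ((N : ℝ) + 2 * s)) := by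
      rw [setLIntegral_const]
    _ ≤ ∫⁻ y in Metric.ball x r \ S,
        ENNReal.ofReal (|v x - v y| ^ 2 / ‖x - y‖ ^ ((N : ℝ) + 2 * s)) :=
      setLIntegral_mono' (Metric.isOpen_ball.measurableSet.diff hSm) hpt
    _ ≤ _ := setLIntegral_le_lintegral _ _
  rw [← ENNReal.ofReal_mul (by positivity)]
  congr 1
  have h1 : r ^ ((N : ℝ) + 2 * s) = (2 * m / κ) ^ (1 + 2 * s / N) := by
    rw [hr, ← Real.rpow_mul (by positivity)]
    congr 1
    field_simp
  have h2 : (κ / 2) ^ (1 + 2 * s / (N : ℝ)) * (2 * m / κ) ^ (1 + 2 * s / (N : ℝ)) =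
      m * m ^ (2 * s / (N : ℝ)) := by
    rw [← Real.mul_rpow (by positivity) (by positivity)]
    have : κ / 2 * (2 * m / κ) = m := by field_simp
    rw [this, Real.rpow_add hm0, Real.rpow_one]
  have h3 : m ^ (2 * s / (N : ℝ)) =
      2 ^ (q * (2 * s / N)) / τ ^ (q * (2 * s / N)) * J ^ (2 * s / (N : ℝ)) := by
    rw [hm, Real.mul_rpow (by positivity) hJ.le, ← Real.rpow_mul (by positivity),
      Real.div_rpow zero_le_two hτ.le]
  have h4 : τ ^ q = τ ^ 2 * τ ^ (q * (2 * s / (N : ℝ))) := by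
    rw [← Real.rpow_two, ← Real.rpow_add hτ, hqe]
  rw [h1, h4, Real.rpow_neg hJ.le, Real.rpow_neg zero_le_two]
  rw [h3] at h2
  have p1 : 0 < (2 * m / κ) ^ (1 + 2 * s / (N : ℝ)) := by positivity
  have p2 : 0 < J ^ (2 * s / (N : ℝ)) := by positivity
  have p3 : 0 < (2 : ℝ) ^ (q * (2 * s / (N : ℝ))) := by positivity
  have p4 : 0 < τ ^ (q * (2 * s / (N : ℝ))) := by positivity
  field_simp at h2 ⊢
  linear_combination 4 * h2

/-- The fractional Sobolev inequality for bounded square integrable functions. -/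
theorem exists_mul_rpow_lintegral_le_of_bounded (hs0 : 0 < s) (hN : 2 * s < (N : ℝ)) :
    ∃ c : ℝ, 0 < c ∧ ∀ v : EuclideanSpace ℝ (Fin N) → ℝ, Measurable v →
      ∫⁻ y, ‖v y‖ₑ ^ (2 : ℝ) ≠ ∞ → ∀ M : ℝ, (∀ x, |v x| ≤ M) →
      ENNReal.ofReal c * (∫⁻ y, ‖v y‖ₑ ^ critExp N s) ^ (1 - 2 * s / (N : ℝ)) ≤
        gagliardoEnergy N s v := by
  have hN0 : (0 : ℝ) < N := by linarith
  have he : 0 < 1 - 2 * s / (N : ℝ) := by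
    rw [sub_pos, div_lt_one hN0]; exact hN
  obtain ⟨c, hc, H⟩ := exists_rpow_le_lintegral_diff (N := N) hs0 hN
  have hq2 := two_lt_critExp hs0 hN
  refine ⟨c, hc, fun v hv hv2 M hM => ?_⟩
  have hM0 : 0 ≤ M := (abs_nonneg _).trans (hM 0)
  set I := ∫⁻ y, ‖v y‖ₑ ^ critExp N s with hI
  -- Boundedness and square integrability make I finite, so that I itself can serve as J in the
  -- pointwise inequality.
  have hfin : I ≠ ∞ := by
    have h1 : I ≤ ENNReal.ofReal (M ^ (critExp N s - 2)) * ∫⁻ y, ‖v y‖ₑ ^ (2 : ℝ) := by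
      rw [← lintegral_const_mul' _ _ ENNReal.ofReal_ne_top]
      refine lintegral_mono fun y => ?_
      have h2 : (0 : ℝ) ≤ critExp N s - 2 := by linarith
      have e : critExp N s = (critExp N s - 2) + 2 := by ring
      nth_rewrite 1 [e]
      rw [ENNReal.rpow_add_of_nonneg _ _ h2 zero_le_two]
      gcongr
      rw [Real.enorm_eq_ofReal_abs, ENNReal.ofReal_rpow_of_nonneg (abs_nonneg _) h2]
      exact ENNReal.ofReal_le_ofReal (Real.rpow_le_rpow (abs_nonneg _) (hM y) h2)
    exact ne_top_of_le_ne_top (ENNReal.mul_ne_top ENNReal.ofReal_ne_top hv2) h1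
  rcases eq_or_ne I 0 with h0 | h0
  · rw [h0, ENNReal.zero_rpow_of_pos he]
    simp
  have hJ : 0 < I.toReal := ENNReal.toReal_pos h0 hfin
  have hIJ : ENNReal.ofReal I.toReal = I := ENNReal.ofReal_toReal hfin
  -- Integrating in x with J = I gives c · I · I^(-2s/N) on the left.
  have key := lintegral_mono (μ := volume) (H v hv I.toReal hJ hIJ.ge)
  refine le_trans (le_of_eq ?_) key
  have e1 : ∀ x, ENNReal.ofReal (c * |v x| ^ critExp N s * I.toReal ^ (-(2 * s / (N : ℝ)))) =
      ENNReal.ofReal (c * I.toReal ^ (-(2 * s / (N : ℝ)))) * ‖v x‖ₑ ^ critExp N s := fun x => by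
    rw [Real.enorm_eq_ofReal_abs, ENNReal.ofReal_rpow_of_nonneg (abs_nonneg _) (by linarith),
      ← ENNReal.ofReal_mul (by positivity)]
    congr 1
    ring
  rw [lintegral_congr e1, lintegral_const_mul' _ _ ENNReal.ofReal_ne_top, ← hI, ← hIJ,
    ENNReal.ofReal_rpow_of_pos hJ, ← ENNReal.ofReal_mul hc.le, ← ENNReal.ofReal_mul (by positivity),
    hIJ]
  congr 1
  rw [sub_eq_add_neg, Real.rpow_add hJ, Real.rpow_one]
  ring

/-- The fractional Sobolev inequality with the critical exponent. -/
theorem exists_mul_rpow_lintegral_le (hs0 : 0 < s) (hN : 2 * s < (N : ℝ)) :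
    ∃ c : ℝ, 0 < c ∧ ∀ v : EuclideanSpace ℝ (Fin N) → ℝ, Measurable v →
      ∫⁻ y, ‖v y‖ₑ ^ (2 : ℝ) ≠ ∞ →
      ENNReal.ofReal c * (∫⁻ y, ‖v y‖ₑ ^ critExp N s) ^ (1 - 2 * s / (N : ℝ)) ≤
        gagliardoEnergy N s v := by
  have hN0 : (0 : ℝ) < N := by linarith
  have he : 0 < 1 - 2 * s / (N : ℝ) := by
    rw [sub_pos, div_lt_one hN0]; exact hN
  obtain ⟨c, hc, H⟩ := exists_mul_rpow_lintegral_le_of_bounded (N := N) hs0 hN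
  have hq2 := two_lt_critExp hs0 hN
  refine ⟨c, hc, fun v hv hv2 => ?_⟩
  have hc' : ENNReal.ofReal c ≠ 0 := by simpa using hc
  -- Truncation at height n is 1-Lipschitz, so it does not increase the energy; the resulting bound
  -- is uniform in n and Fatou's lemma removes the truncation.
  set w : ℕ → EuclideanSpace ℝ (Fin N) → ℝ := fun n x => max (-(n : ℝ)) (min (v x) n)
  have hw : ∀ n, Measurable (w n) := fun n => measurable_const.max (hv.min measurable_const)
  have hwM : ∀ n x, |w n x| ≤ n := fun n x => abs_le.2
    ⟨le_max_left _ _, max_le (by have : (0 : ℝ) ≤ n := n.cast_nonneg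
                                 linarith) (min_le_right _ _)⟩
  have hwd : ∀ n x y, |w n x - w n y| ≤ |v x - v y| := fun n x y => by
    refine (abs_max_sub_max_le_max _ _ _ _).trans ?_
    rw [sub_self, abs_zero]
    refine max_le (abs_nonneg _) ((abs_min_sub_min_le_max _ _ _ _).trans ?_)
    rw [sub_self, abs_zero]
    exact max_le le_rfl (abs_nonneg _)
  have hw0 : ∀ n x, |w n x| ≤ |v x| := fun n x => by
    have hn : (0 : ℝ) ≤ n := n.cast_nonneg
    simp only [w]
    rcases le_total 0 (v x) with h | h
    · rw [max_eq_right (by have := le_min h hn; linarith), abs_of_nonneg (le_min h hn),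
        abs_of_nonneg h]
      exact min_le_left _ _
    · rw [min_eq_left (by linarith), abs_of_nonpos (max_le (by linarith) h), abs_of_nonpos h]
      exact neg_le_neg (le_max_right _ _)
  have hw2 : ∀ n, ∫⁻ y, ‖w n y‖ₑ ^ (2 : ℝ) ≠ ∞ := fun n => by
    refine ne_top_of_le_ne_top hv2 (lintegral_mono fun y => ?_)
    have := hw0 n y
    gcongr
    rw [Real.enorm_eq_ofReal_abs, Real.enorm_eq_ofReal_abs]
    exact ENNReal.ofReal_le_ofReal this
  have hbound : ∀ n, ∫⁻ y, ‖w n y‖ₑ ^ critExp N s ≤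
      (gagliardoEnergy N s v / ENNReal.ofReal c) ^ (1 - 2 * s / (N : ℝ))⁻¹ := fun n => by
    rw [ENNReal.le_rpow_inv_iff he, ENNReal.le_div_iff_mul_le (Or.inl hc')
      (Or.inl ENNReal.ofReal_ne_top), mul_comm]
    exact (H (w n) (hw n) (hw2 n) n (hwM n)).trans (gagliardoEnergy_mono (hwd n))
  have hlim : ∀ y, liminf (fun n => ‖w n y‖ₑ ^ critExp N s) atTop = ‖v y‖ₑ ^ critExp N s := by
    intro y
    refine Tendsto.liminf_eq (tendsto_const_nhds.congr' ?_)
    filter_upwards [eventually_ge_atTop ⌈|v y|⌉₊] with n hn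
    have h1 : |v y| ≤ n := Nat.ceil_le.1 hn
    have : w n y = v y := by
      simp only [w]
      rw [min_eq_left ((le_abs_self _).trans h1), max_eq_right (abs_le.1 h1).1]
    rw [this]
  have hF := lintegral_liminf_le (μ := volume) (u := (atTop : Filter ℕ))
    (f := fun n y => ‖w n y‖ₑ ^ critExp N s) (fun n => (hw n).enorm.pow_const _)
  rw [lintegral_congr hlim] at hF
  have h2 : liminf (fun n => ∫⁻ y, ‖w n y‖ₑ ^ critExp N s) atTop ≤
      (gagliardoEnergy N s v / ENNReal.ofReal c) ^ (1 - 2 * s / (N : ℝ))⁻¹ :=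
    (liminf_le_liminf (Eventually.of_forall hbound)).trans (by simp)
  have h3 := hF.trans h2
  rwa [ENNReal.le_rpow_inv_iff he, ENNReal.le_div_iff_mul_le (Or.inl hc')
      (Or.inl ENNReal.ofReal_ne_top), mul_comm] at h3

/-- The fractional Sobolev inequality, for the `L^q` norm with `q` critical. -/
theorem exists_eLpNorm_critExp_le (hs0 : 0 < s) (hN : 2 * s < (N : ℝ)) :
    ∃ C : ℝ≥0∞, C ≠ ∞ ∧ ∀ v : EuclideanSpace ℝ (Fin N) → ℝ, Measurable v →
      MemLp v 2 volume →
      eLpNorm v (ENNReal.ofReal (critExp N s)) volume ≤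
        C * gagliardoEnergy N s v ^ (1 / 2 : ℝ) := by
  have hN0 : (0 : ℝ) < N := by linarith
  have he : 1 - 2 * s / (N : ℝ) = 2 / critExp N s := by
    unfold critExp
    have : (N : ℝ) - 2 * s ≠ 0 := by linarith
    field_simp
  obtain ⟨c, hc, H⟩ := exists_mul_rpow_lintegral_le (N := N) hs0 hN
  have hq2 := two_lt_critExp hs0 hN
  have hc' : ENNReal.ofReal c ≠ 0 := by simpa using hc
  refine ⟨(ENNReal.ofReal c)⁻¹ ^ (1 / 2 : ℝ),
    ENNReal.rpow_ne_top_of_nonneg (by norm_num) (ENNReal.inv_ne_top.2 hc'), fun v hv hv2 => ?_⟩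
  have h2 : ∫⁻ y, ‖v y‖ₑ ^ (2 : ℝ) ≠ ∞ := by
    have := lintegral_rpow_enorm_lt_top_of_eLpNorm_lt_top two_ne_zero ENNReal.ofNat_ne_top hv2.2
    simpa using this.ne
  have h3 := H v hv h2
  rw [eLpNorm_eq_lintegral_rpow_enorm_toReal (by simp; linarith) ENNReal.ofReal_ne_top,
    ENNReal.toReal_ofReal (by linarith), ← ENNReal.mul_rpow_of_nonneg _ _ (by norm_num)]
  have e : 1 / critExp N s = 2 / critExp N s * (1 / 2) := by ring
  rw [e, ENNReal.rpow_mul]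
  refine ENNReal.rpow_le_rpow ?_ (by norm_num)
  rw [he] at h3
  rwa [mul_comm, ← div_eq_mul_inv, ENNReal.le_div_iff_mul_le (Or.inl hc')
      (Or.inl ENNReal.ofReal_ne_top), mul_comm]

end Gagliardo

/-! ### Approximation by step functions on small cubes -/

theorem coeFn_Lp_sum {α ι : Type*} [MeasurableSpace α] {μ : Measure α} (T : Finset ι)
    (F : ι → Lp ℝ 2 μ) : ⇑(∑ k ∈ T, F k) =ᵐ[μ] fun x => ∑ k ∈ T, F k x := by
  classical
  induction T using Finset.induction_on with
  | empty =>
    filter_upwards [Lp.coeFn_zero ℝ 2 μ] with x hx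
    simpa using hx
  | insert k T hk ih =>
    rw [Finset.sum_insert hk]
    filter_upwards [ih, Lp.coeFn_add (F k) (∑ k ∈ T, F k)] with x h1 h2
    rw [h2, Pi.add_apply, h1, Finset.sum_insert hk]

section Cubes

variable {N : ℕ} {s : ℝ} {Ω : Set (EuclideanSpace ℝ (Fin N))}

/-- The index of the half-open cube of side `h` of the standard grid that contains `x`. -/
noncomputable def cubeIndex (h : ℝ) (x : EuclideanSpace ℝ (Fin N)) (i : Fin N) : ℤ := ⌊x i / h⌋

/-- The half-open cube of side `h` with index `k`. -/
def cube (h : ℝ) (k : Fin N → ℤ) : Set (EuclideanSpace ℝ (Fin N)) := {x | cubeIndex h x = k}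

theorem mem_cube {h : ℝ} {k : Fin N → ℤ} {x : EuclideanSpace ℝ (Fin N)} :
    x ∈ cube h k ↔ cubeIndex h x = k := Iff.rfl

theorem cube_eq_preimage {h : ℝ} (hh : 0 < h) (k : Fin N → ℤ) :
    cube h k = (MeasurableEquiv.toLp 2 (Fin N → ℝ)).symm ⁻¹'
      Set.pi Set.univ fun i => Set.Ico (k i * h) ((k i + 1) * h) := by
  ext x
  rw [mem_cube, Set.mem_preimage, Set.mem_univ_pi, funext_iff]
  refine forall_congr' fun i => ?_
  rw [cubeIndex, Int.floor_eq_iff, le_div_iff₀ hh, div_lt_iff₀ hh]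
  rfl

theorem measurableSet_cube {h : ℝ} (hh : 0 < h) (k : Fin N → ℤ) : MeasurableSet (cube h k) := by
  rw [cube_eq_preimage hh]
  exact (MeasurableEquiv.measurable _) (MeasurableSet.univ_pi fun i => measurableSet_Ico)

theorem volume_cube {h : ℝ} (hh : 0 < h) (k : Fin N → ℤ) :
    volume (cube h k) = ENNReal.ofReal (h ^ N) := by
  rw [cube_eq_preimage hh, (EuclideanSpace.volume_preserving_symm_measurableEquiv_toLp
    (Fin N)).measure_preimage (MeasurableSet.univ_pi fun i => measurableSet_Ico).nullMeasurableSet,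
    Real.volume_pi_Ico]
  have : ∀ i, ((k i : ℝ) + 1) * h - k i * h = h := fun i => by ring
  simp only [this, Finset.prod_const, Finset.card_univ, Fintype.card_fin]
  rw [ENNReal.ofReal_pow hh.le]

theorem norm_sub_le_of_mem_cube {h : ℝ} (hh : 0 < h) {k : Fin N → ℤ}
    {x y : EuclideanSpace ℝ (Fin N)} (hx : x ∈ cube h k) (hy : y ∈ cube h k) :
    ‖x - y‖ ≤ Real.sqrt N * h := by
  rw [EuclideanSpace.norm_eq]
  have h1 : ∀ i, ‖(x - y) i‖ ^ 2 ≤ h ^ 2 := fun i => by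
    have hxi := congrFun hx i
    have hyi := congrFun hy i
    rw [cubeIndex, Int.floor_eq_iff, le_div_iff₀ hh, div_lt_iff₀ hh] at hxi hyi
    rw [Real.norm_eq_abs, sq_abs]
    refine sq_le_sq' ?_ ?_ <;> simp only [PiLp.sub_apply] <;> nlinarith [hxi.1, hxi.2, hyi.1, hyi.2]
  calc Real.sqrt (∑ i, ‖(x - y) i‖ ^ 2) ≤ Real.sqrt (∑ _i : Fin N, h ^ 2) :=
        Real.sqrt_le_sqrt (Finset.sum_le_sum fun i _ => h1 i)
    _ = Real.sqrt N * h := by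
        rw [Finset.sum_const, Finset.card_univ, Fintype.card_fin, nsmul_eq_mul,
          Real.sqrt_mul (Nat.cast_nonneg _), Real.sqrt_sq hh.le]

theorem exists_finset_cubeIndex_mem (hΩ : Bornology.IsBounded Ω) {h : ℝ} (hh : 0 < h) :
    ∃ T : Finset (Fin N → ℤ), ∀ x ∈ Ω, cubeIndex h x ∈ T := by
  obtain ⟨R, hR⟩ := hΩ.exists_norm_le
  refine ⟨Fintype.piFinset fun _ => Finset.Icc ⌊-R / h⌋ ⌊R / h⌋, fun x hx => ?_⟩
  rw [Fintype.mem_piFinset]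
  intro i
  have h1 := abs_le.1 (((Real.norm_eq_abs _).symm.le.trans (PiLp.norm_apply_le x i)).trans (hR x hx))
  rw [Finset.mem_Icc]
  exact ⟨Int.floor_le_floor (div_le_div_of_nonneg_right h1.1 hh.le),
    Int.floor_le_floor (div_le_div_of_nonneg_right h1.2 hh.le)⟩

/-- On a cube, some value of `u` approximates `u` in mean square, up to the part of the Gagliardo
energy carried by the cube. -/
theorem exists_value_lintegral_sub_sq_le (hs0 : 0 < s) {u : EuclideanSpace ℝ (Fin N) → ℝ}
    (hu : Measurable u) {h : ℝ} (hh : 0 < h) (k : Fin N → ℤ) :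
    ∃ c : ℝ, ∫⁻ x in cube h k, ENNReal.ofReal (|c - u x| ^ 2) ≤
      ENNReal.ofReal ((Real.sqrt N * h) ^ ((N : ℝ) + 2 * s) / h ^ N) *
        ∫⁻ y in cube h k, ∫⁻ x, ENNReal.ofReal (|u y - u x| ^ 2 / ‖y - x‖ ^ ((N : ℝ) + 2 * s)) := by
  have hN0 : (0 : ℝ) ≤ N := N.cast_nonneg
  have hQ := measurableSet_cube hh k
  have hvol := volume_cube hh k
  have hh' : 0 < h ^ N := by positivity
  set d : ℝ := (Real.sqrt N * h) ^ ((N : ℝ) + 2 * s)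
  have hd0 : 0 ≤ d := by positivity
  have hmeas : Measurable fun q : EuclideanSpace ℝ (Fin N) × EuclideanSpace ℝ (Fin N) =>
      ENNReal.ofReal (|u q.1 - u q.2| ^ 2) := by
    refine ENNReal.measurable_ofReal.comp ?_
    have h1 : Measurable fun q : EuclideanSpace ℝ (Fin N) × EuclideanSpace ℝ (Fin N) =>
      u q.1 - u q.2 := (hu.comp measurable_fst).sub (hu.comp measurable_snd)
    simpa only [sq_abs] using h1.pow_const 2
  -- The constant is the value of u at a point where the inner integral does not exceed its average
  -- over the cube.
  obtain ⟨y, -, hy⟩ := exists_le_setLAverage (μ := volume) (s := cube h k)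
    (f := fun y => ∫⁻ x in cube h k, ENNReal.ofReal (|u y - u x| ^ 2))
    (by rw [hvol]; simpa using hh') (by rw [hvol]; exact ENNReal.ofReal_ne_top)
    (hmeas.lintegral_prod_right').aemeasurable
  refine ⟨u y, hy.trans ?_⟩
  rw [setLAverage_eq, hvol, ENNReal.ofReal_div_of_pos hh']
  have h1 : ∫⁻ y in cube h k, ∫⁻ x in cube h k, ENNReal.ofReal (|u y - u x| ^ 2) ≤
      ENNReal.ofReal d * ∫⁻ y in cube h k, ∫⁻ x,
        ENNReal.ofReal (|u y - u x| ^ 2 / ‖y - x‖ ^ ((N : ℝ) + 2 * s)) := by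
    rw [← lintegral_const_mul' _ _ ENNReal.ofReal_ne_top]
    refine setLIntegral_mono' hQ fun y hy => ?_
    rw [← lintegral_const_mul' _ _ ENNReal.ofReal_ne_top]
    refine (setLIntegral_mono' hQ fun x hx => ?_).trans (setLIntegral_le_lintegral (cube h k) _)
    rw [← ENNReal.ofReal_mul hd0]
    refine ENNReal.ofReal_le_ofReal ?_
    rcases eq_or_ne y x with rfl | hne
    · simp
    · have h2 : 0 < ‖y - x‖ := norm_pos_iff.2 (sub_ne_zero.2 hne)
      have h3 : ‖y - x‖ ^ ((N : ℝ) + 2 * s) ≤ d :=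
        Real.rpow_le_rpow h2.le (norm_sub_le_of_mem_cube hh hy hx) (by linarith)
      have h4 : 0 < ‖y - x‖ ^ ((N : ℝ) + 2 * s) := Real.rpow_pos_of_pos h2 _
      rw [mul_div_assoc', le_div_iff₀ h4, mul_comm]
      exact mul_le_mul_of_nonneg_right h3 (sq_nonneg _)
  calc _ ≤ (ENNReal.ofReal d * ∫⁻ y in cube h k, ∫⁻ x,
        ENNReal.ofReal (|u y - u x| ^ 2 / ‖y - x‖ ^ ((N : ℝ) + 2 * s))) / ENNReal.ofReal (h ^ N) :=
        ENNReal.div_le_div_right h1 _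
    _ = _ := by rw [div_eq_mul_inv, div_eq_mul_inv]; ring

/-- A function with finite Gagliardo energy that vanishes outside a bounded set is close, in
`L²`, to a step function on a grid of small cubes. -/
theorem exists_finiteDimensional_approx (hs0 : 0 < s) (hΩ : Bornology.IsBounded Ω) {h : ℝ}
    (hh : 0 < h) :
    ∃ V : Submodule ℝ (Lp ℝ 2 (volume : Measure (EuclideanSpace ℝ (Fin N)))),
      FiniteDimensional ℝ V ∧ ∀ u : X N s Ω, ∃ v ∈ V, ‖(u : Lp ℝ 2 volume) - v‖ₑ ≤
        (ENNReal.ofReal ((Real.sqrt N * h) ^ ((N : ℝ) + 2 * s) / h ^ N) *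
          gagliardoEnergy N s (u : Lp ℝ 2 volume)) ^ (1 / 2 : ℝ) := by
  classical
  obtain ⟨T, hT⟩ := exists_finset_cubeIndex_mem hΩ hh
  have hfin : ∀ k : Fin N → ℤ, volume (cube h k) ≠ ∞ := fun k => by
    rw [volume_cube hh]; exact ENNReal.ofReal_ne_top
  set e : (Fin N → ℤ) → Lp ℝ 2 (volume : Measure (EuclideanSpace ℝ (Fin N))) := fun k =>
    indicatorConstLp 2 (measurableSet_cube hh k) (hfin k) (1 : ℝ)
  -- Finitely many cubes cover Ω, and u vanishes almost everywhere outside Ω, so no other cube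
  -- contributes to the error.
  refine ⟨Submodule.span ℝ (e '' T), FiniteDimensional.span_of_finite ℝ (T.finite_toSet.image e),
    fun u => ?_⟩
  have hu : Measurable (u.1 : EuclideanSpace ℝ (Fin N) → ℝ) :=
    (Lp.stronglyMeasurable u.1).measurable
  choose c hc using exists_value_lintegral_sub_sq_le (N := N) hs0 hu hh
  refine ⟨∑ k ∈ T, c k • e k, Submodule.sum_mem _ fun k hk => Submodule.smul_mem _ _
    (Submodule.subset_span ⟨k, hk, rfl⟩), ?_⟩
  have hsum : (∑ k ∈ T, c k • e k : Lp ℝ 2 volume) =ᵐ[volume]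
      fun x => if cubeIndex h x ∈ T then c (cubeIndex h x) else 0 := by
    have h1 : ∀ᵐ x, ∀ k ∈ T, (c k • e k : Lp ℝ 2 volume) x =
        if cubeIndex h x = k then c k else 0 := by
      rw [eventually_all_finset]
      intro k _
      filter_upwards [Lp.coeFn_smul (c k) (e k), indicatorConstLp_coeFn (p := 2)
        (hs := measurableSet_cube hh k) (hμs := hfin k) (c := (1 : ℝ))] with x h1 h2
      rw [h1, Pi.smul_apply, h2, Set.indicator_apply]
      simp only [mem_cube]
      split_ifs <;> simp
    filter_upwards [h1, coeFn_Lp_sum T fun k => c k • e k] with x h2 h3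
    rw [h3, Finset.sum_congr rfl h2, Finset.sum_ite_eq]
  have hzero := u.2.2
  rw [Lp.enorm_def, eLpNorm_eq_lintegral_rpow_enorm_toReal two_ne_zero ENNReal.ofNat_ne_top]
  simp only [ENNReal.toReal_ofNat]
  refine ENNReal.rpow_le_rpow ?_ (by norm_num)
  calc ∫⁻ x, ‖((u : Lp ℝ 2 volume) - ∑ k ∈ T, c k • e k : Lp ℝ 2 volume) x‖ₑ ^ (2 : ℝ)
      ≤ ∫⁻ x, ∑ k ∈ T, (cube h k).indicator
          (fun x => ENNReal.ofReal (|c k - (u : Lp ℝ 2 volume) x| ^ 2)) x := by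
        refine lintegral_mono_ae ?_
        filter_upwards [hsum, hzero, Lp.coeFn_sub (u : Lp ℝ 2 volume) (∑ k ∈ T, c k • e k)]
          with x h1 h2 h3
        rw [h3, Pi.sub_apply, h1]
        simp only [Set.indicator_apply, mem_cube, Finset.sum_ite_eq]
        split_ifs with hx
        · rw [Real.enorm_eq_ofReal_abs, ENNReal.ofReal_rpow_of_nonneg (abs_nonneg _) zero_le_two,
            abs_sub_comm, Real.rpow_two]
        · rw [h2 fun hxΩ => hx (hT x hxΩ)]
          simp
    _ = ∑ k ∈ T, ∫⁻ x in cube h k, ENNReal.ofReal (|c k - (u : Lp ℝ 2 volume) x| ^ 2) := by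
        rw [lintegral_finsetSum]
        · exact Finset.sum_congr rfl fun k _ => lintegral_indicator (measurableSet_cube hh k) _
        · intro k _
          refine Measurable.indicator ?_ (measurableSet_cube hh k)
          refine ENNReal.measurable_ofReal.comp ?_
          have h1 : Measurable fun x => c k - u.1 x := measurable_const.sub hu
          simpa only [sq_abs] using h1.pow_const 2
    _ ≤ ∑ k ∈ T, ENNReal.ofReal ((Real.sqrt N * h) ^ ((N : ℝ) + 2 * s) / h ^ N) *
        ∫⁻ y in cube h k, ∫⁻ x, ENNReal.ofReal (|(u : Lp ℝ 2 volume) y - (u : Lp ℝ 2 volume) x| ^ 2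
          / ‖y - x‖ ^ ((N : ℝ) + 2 * s)) := Finset.sum_le_sum fun k _ => hc k
    _ ≤ _ := by
        rw [← Finset.mul_sum, ← lintegral_biUnion_finset]
        · gcongr
          exact setLIntegral_le_lintegral _ _
        · intro k _ l _ hkl
          exact Set.disjoint_left.2 fun x hx hx' => hkl (hx.symm.trans hx')
        · exact fun k _ => measurableSet_cube hh k

/-- The approximants lie in a ball of a finite-dimensional space, which is compact; a finite net for
that ball is a net for `S`. -/
theorem totallyBounded_of_finiteDimensional_approx {E : Type*} [NormedAddCommGroup E]
    [NormedSpace ℝ E] {S : Set E} (hS : Bornology.IsBounded S)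
    (h : ∀ ε > 0, ∃ V : Submodule ℝ E, FiniteDimensional ℝ V ∧ ∀ u ∈ S, ∃ v ∈ V, ‖u - v‖ ≤ ε) :
    TotallyBounded S := by
  rw [Metric.totallyBounded_iff]
  intro ε hε
  obtain ⟨R, hR⟩ := hS.exists_norm_le
  obtain ⟨V, hV, hSV⟩ := h (ε / 2) (by positivity)
  have hc : IsCompact ((↑) '' Metric.closedBall (0 : V) (R + ε / 2) : Set E) :=
    (isCompact_closedBall _ _).image continuous_subtype_val
  obtain ⟨t, ht, htc⟩ := Metric.totallyBounded_iff.1 hc.totallyBounded (ε / 2) (by positivity)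
  refine ⟨t, ht, fun u hu => ?_⟩
  obtain ⟨v, hv, huv⟩ := hSV u hu
  have hvR : ‖v‖ ≤ R + ε / 2 := by
    have := norm_le_norm_add_norm_sub' v u
    rw [norm_sub_rev] at this
    exact this.trans (add_le_add (hR u hu) (by rwa [norm_sub_rev] at huv ⊢))
  have := htc ⟨⟨v, hv⟩, by simpa using hvR, rfl⟩
  simp only [Set.mem_iUnion, Metric.mem_ball, exists_prop] at this ⊢
  obtain ⟨y, hy, hvy⟩ := this
  refine ⟨y, hy, ?_⟩
  calc dist u y ≤ dist u v + dist v y := dist_triangle _ _ _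
    _ < ε / 2 + ε / 2 := add_lt_add_of_le_of_lt (by rwa [dist_eq_norm]) hvy
    _ = ε := by ring

end Cubes

/-! ### Weighted integrals and interpolation -/

section WeightedIntegrals

/-- Absorbing |w|^(1/r) into f turns a weighted integral into the r-th power of an L^r norm, whose
continuity is known. -/
theorem abs_rpow_weight_mul {α : Type*} (w f : α → ℝ) {r : ℝ} (hr : 1 ≤ r) (x : α) :
    ‖|w x| ^ (1 / r) * f x‖ ^ (ENNReal.ofReal r).toReal = |w x| * |f x| ^ r := by
  have hr0 : 0 < r := by linarith
  rw [ENNReal.toReal_ofReal hr0.le, norm_mul, Real.norm_eq_abs, Real.norm_eq_abs,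
    abs_of_nonneg (Real.rpow_nonneg (abs_nonneg _) _), Real.mul_rpow (by positivity) (abs_nonneg _),
    ← Real.rpow_mul (abs_nonneg _), one_div_mul_cancel hr0.ne', Real.rpow_one]

variable {α : Type*} [MeasurableSpace α] {μ : Measure α}

theorem memLp_rpow_weight_mul {w f : α → ℝ} (hw : MemLp w ∞ μ) {r : ℝ} (hr : 1 ≤ r)
    (hf : MemLp f (ENNReal.ofReal r) μ) :
    MemLp (fun x => |w x| ^ (1 / r) * f x) (ENNReal.ofReal r) μ := by
  have h1 := hw.norm_rpow_div (ENNReal.ofReal (1 / r))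
  rw [ENNReal.top_div_of_ne_top ENNReal.ofReal_ne_top, ENNReal.toReal_ofReal (by positivity)] at h1
  exact hf.mul h1

theorem integrable_abs_weight_mul {w f : α → ℝ} (hw : MemLp w ∞ μ) {r : ℝ} (hr : 1 ≤ r)
    (hf : MemLp f (ENNReal.ofReal r) μ) : Integrable (fun x => |w x| * |f x| ^ r) μ := by
  have h := (memLp_rpow_weight_mul hw hr hf).integrable_norm_rpow (by simp; linarith)
    ENNReal.ofReal_ne_top
  exact h.congr (Eventually.of_forall fun x => abs_rpow_weight_mul w f hr x)

theorem integrable_weight_mul {w f : α → ℝ} (hw : MemLp w ∞ μ) {r : ℝ} (hr : 1 ≤ r)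
    (hf : MemLp f (ENNReal.ofReal r) μ) : Integrable (fun x => w x * |f x| ^ r) μ := by
  refine (integrable_abs_weight_mul hw hr hf).mono' ?_ (Eventually.of_forall fun x => ?_)
  · exact hw.1.mul ((hf.1.aemeasurable.abs.pow_const r).aestronglyMeasurable)
  · rw [norm_mul, Real.norm_eq_abs, Real.norm_eq_abs,
      abs_of_nonneg (Real.rpow_nonneg (abs_nonneg _) _)]

theorem integral_abs_weight_mul_eq {w f : α → ℝ} (hw : MemLp w ∞ μ) {r : ℝ} (hr : 1 ≤ r)
    (hf : MemLp f (ENNReal.ofReal r) μ) :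
    ∫ x, |w x| * |f x| ^ r ∂μ =
      (eLpNorm (fun x => |w x| ^ (1 / r) * f x) (ENNReal.ofReal r) μ).toReal ^ r := by
  have hr0 : 0 < r := by linarith
  have hnn : 0 ≤ ∫ x, |w x| * |f x| ^ r ∂μ := integral_nonneg fun x => by positivity
  rw [(memLp_rpow_weight_mul hw hr hf).eLpNorm_eq_integral_rpow_norm (by simpa using hr0)
    ENNReal.ofReal_ne_top]
  simp only [abs_rpow_weight_mul w f hr]
  rw [ENNReal.toReal_ofReal hr0.le, ENNReal.toReal_ofReal (by positivity), ← Real.rpow_mul hnn,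
    inv_mul_cancel₀ hr0.ne', Real.rpow_one]

theorem tendsto_integral_abs_weight_mul {w : α → ℝ} (hw : MemLp w ∞ μ) {r : ℝ} (hr : 1 ≤ r)
    {ι : Type*} {l : Filter ι} {F : ι → α → ℝ} {f : α → ℝ}
    (hF : ∀ i, MemLp (F i) (ENNReal.ofReal r) μ) (hf : MemLp f (ENNReal.ofReal r) μ)
    (h : Tendsto (fun i => eLpNorm (F i - f) (ENNReal.ofReal r) μ) l (𝓝 0)) :
    Tendsto (fun i => ∫ x, |w x| * |F i x| ^ r ∂μ) l (𝓝 (∫ x, |w x| * |f x| ^ r ∂μ)) := by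
  have : Fact (1 ≤ ENNReal.ofReal r) := ⟨by simpa using hr⟩
  rw [integral_abs_weight_mul_eq hw hr hf]
  simp only [fun i => integral_abs_weight_mul_eq hw hr (hF i)]
  refine Tendsto.rpow_const ?_ (Or.inr (by linarith))
  have hT := (Lp.tendsto_Lp_iff_tendsto_eLpNorm'' (fi := l) _
    (fun i => memLp_rpow_weight_mul hw hr (hF i)) _ (memLp_rpow_weight_mul hw hr hf)).2 ?_
  · have := hT.norm
    simpa only [Lp.norm_toLp] using this
  · have hb := hw.norm_rpow_div (ENNReal.ofReal (1 / r))
    rw [ENNReal.top_div_of_ne_top ENNReal.ofReal_ne_top,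
      ENNReal.toReal_ofReal (by positivity)] at hb
    have h2 := ENNReal.Tendsto.const_mul (a := eLpNorm (fun x => ‖w x‖ ^ (1 / r)) ∞ μ) h
      (Or.inr hb.2.ne)
    rw [mul_zero] at h2
    refine tendsto_of_tendsto_of_tendsto_of_le_of_le tendsto_const_nhds h2 (fun i => zero_le)
      fun i => ?_
    refine le_trans (le_of_eq ?_) (eLpNorm_smul_le_eLpNorm_top_mul_eLpNorm _
      ((hF i).1.sub hf.1) (fun x => ‖w x‖ ^ (1 / r)))
    congr 1
    ext x
    simp only [Pi.sub_apply, Pi.smul_apply', smul_eq_mul, Real.norm_eq_abs]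
    ring

/-- Weighted integrals of `|f|^r` are continuous in `f` for the `L^r` distance. -/
theorem tendsto_integral_weight_mul {w : α → ℝ} (hw : MemLp w ∞ μ) {r : ℝ} (hr : 1 ≤ r)
    {ι : Type*} {l : Filter ι} {F : ι → α → ℝ} {f : α → ℝ}
    (hF : ∀ i, MemLp (F i) (ENNReal.ofReal r) μ) (hf : MemLp f (ENNReal.ofReal r) μ)
    (h : Tendsto (fun i => eLpNorm (F i - f) (ENNReal.ofReal r) μ) l (𝓝 0)) :
    Tendsto (fun i => ∫ x, w x * |F i x| ^ r ∂μ) l (𝓝 (∫ x, w x * |f x| ^ r ∂μ)) := by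
  -- The weight may change sign, so it is split into its positive and negative parts.
  have e : ∀ u : α → ℝ, MemLp u (ENNReal.ofReal r) μ → ∫ x, w x * |u x| ^ r ∂μ =
      ∫ x, |max (w x) 0| * |u x| ^ r ∂μ - ∫ x, |max (-w x) 0| * |u x| ^ r ∂μ := by
    intro u hu
    rw [← integral_sub (integrable_abs_weight_mul hw.pos_part hr hu)
      (integrable_abs_weight_mul hw.neg_part hr hu)]
    congr 1
    ext x
    rw [abs_of_nonneg (le_max_right (w x) 0), abs_of_nonneg (le_max_right (-w x) 0), ← sub_mul]
    congr 1
    rcases le_total 0 (w x) with hx | hx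
    · rw [max_eq_left hx, max_eq_right (by linarith), sub_zero]
    · rw [max_eq_right hx, max_eq_left (by linarith), zero_sub, neg_neg]
  rw [e f hf]
  simp only [fun i => e (F i) (hF i)]
  exact (tendsto_integral_abs_weight_mul hw.pos_part hr hF hf h).sub
    (tendsto_integral_abs_weight_mul hw.neg_part hr hF hf h)

/-- Interpolation of the `L^p` norm between `L²` and `L^q`. -/
theorem exists_eLpNorm_le_interpolation {p q : ℝ} (hp : 2 ≤ p) (hpq : p < q) :
    ∃ c d : ℝ, 0 < c ∧ 0 ≤ d ∧ ∀ f : α → ℝ, AEStronglyMeasurable f μ →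
      eLpNorm f (ENNReal.ofReal p) μ ≤
        eLpNorm f 2 μ ^ c * eLpNorm f (ENNReal.ofReal q) μ ^ d := by
  have hp0 : 0 < p := by linarith
  have hq0 : 0 < q := by linarith
  have hq2 : 0 < q - 2 := by linarith
  -- The weight for which p = 2t + q(1-t), as Hölder's inequality requires. Since p < q it is
  -- positive, so the L² norm enters with a positive power.
  set t : ℝ := (q - p) / (q - 2) with ht
  have ht0 : 0 < t := div_pos (by linarith) hq2
  have ht1 : 0 ≤ 1 - t := by
    rw [sub_nonneg, ht, div_le_one hq2]; linarith
  have hpt : p = 2 * t + q * (1 - t) := by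
    rw [ht]; field_simp; ring
  refine ⟨2 * t / p, q * (1 - t) / p, by positivity, by positivity, fun f hf => ?_⟩
  rw [eLpNorm_eq_lintegral_rpow_enorm_toReal (by simpa using hp0) ENNReal.ofReal_ne_top,
    eLpNorm_eq_lintegral_rpow_enorm_toReal (by simpa using hq0) ENNReal.ofReal_ne_top,
    eLpNorm_eq_lintegral_rpow_enorm_toReal two_ne_zero ENNReal.ofNat_ne_top,
    ENNReal.toReal_ofReal hp0.le, ENNReal.toReal_ofReal hq0.le, ENNReal.toReal_ofNat,
    ← ENNReal.rpow_mul, ← ENNReal.rpow_mul]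
  have h1 := ENNReal.lintegral_mul_norm_pow_le (μ := μ) (f := fun x => ‖f x‖ₑ ^ (2 : ℝ))
    (g := fun x => ‖f x‖ₑ ^ q) (hf.enorm.pow_const _) (hf.enorm.pow_const _) ht0.le ht1 (by ring)
  have h2 : ∀ x, (‖f x‖ₑ ^ (2 : ℝ)) ^ t * (‖f x‖ₑ ^ q) ^ (1 - t) = ‖f x‖ₑ ^ p := fun x => by
    rw [← ENNReal.rpow_mul, ← ENNReal.rpow_mul, ← ENNReal.rpow_add_of_nonneg _ _ (by positivity)
      (by positivity), ← hpt]
  simp only [h2] at h1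
  refine (ENNReal.rpow_le_rpow h1 (by positivity : 0 ≤ 1 / p)).trans (le_of_eq ?_)
  rw [ENNReal.mul_rpow_of_nonneg _ _ (by positivity), ← ENNReal.rpow_mul, ← ENNReal.rpow_mul]
  congr 2 <;> field_simp

end WeightedIntegrals

/-! ### The norm of X and its embeddings -/

section Space

variable {N : ℕ} {s : ℝ} {Ω : Set (EuclideanSpace ℝ (Fin N))}

theorem measurable_coe (u : X N s Ω) : Measurable u.1 :=
  (Lp.stronglyMeasurable u.1).measurable

theorem coeFn_sub (u v : X N s Ω) :
    (u - v).1 =ᵐ[volume]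
      u.1 - v.1 :=
  Lp.coeFn_sub u.1 v.1

theorem coeFn_smul (c : ℝ) (u : X N s Ω) :
    (c • u).1 =ᵐ[volume] c • ⇑u.1 :=
  Lp.coeFn_smul c u.1

theorem normX_nonneg (u : X N s Ω) : 0 ≤ normX u := Real.sqrt_nonneg _

theorem sqrt_gagliardoEnergy_eq (u : X N s Ω) :
    gagliardoEnergy N s u.1 ^ (1 / 2 : ℝ) = ENNReal.ofReal (normX u) := by
  rw [normX, Real.sqrt_eq_rpow, ENNReal.toReal_rpow, ENNReal.ofReal_toReal]
  exact ENNReal.rpow_ne_top_of_nonneg (by norm_num) u.2.1.ne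

theorem gagliardoEnergy_eq (u : X N s Ω) :
    gagliardoEnergy N s u.1 = ENNReal.ofReal (normX u ^ 2) := by
  rw [normX, Real.sq_sqrt ENNReal.toReal_nonneg, ENNReal.ofReal_toReal u.2.1.ne]

theorem normX_smul (c : ℝ) (u : X N s Ω) : normX (c • u) = |c| * normX u := by
  rw [normX, normX, gagliardoEnergy_congr (coeFn_smul c u), gagliardoEnergy_smul,
    ENNReal.toReal_mul, ENNReal.toReal_ofReal (sq_nonneg c), Real.sqrt_mul (sq_nonneg c),
    Real.sqrt_sq_eq_abs]

theorem normX_add_le (u v : X N s Ω) : normX (u + v) ≤ normX u + normX v := by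
  have h := sqrt_gagliardoEnergy_add_le (s := s) (measurable_coe u) (measurable_coe v)
  rw [← gagliardoEnergy_congr (Lp.coeFn_add u.1 v.1), ← Submodule.coe_add,
    sqrt_gagliardoEnergy_eq, sqrt_gagliardoEnergy_eq, sqrt_gagliardoEnergy_eq,
    ← ENNReal.ofReal_add (normX_nonneg _) (normX_nonneg _)] at h
  exact (ENNReal.ofReal_le_ofReal_iff (add_nonneg (normX_nonneg _) (normX_nonneg _))).1 h

theorem abs_normX_sub_le (u v : X N s Ω) : |normX u - normX v| ≤ normX (u - v) := by
  have h1 := normX_add_le (u - v) v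
  have h2 := normX_add_le (v - u) u
  have h3 : normX (v - u) = normX (u - v) := by
    have := normX_smul (-1) (u - v)
    rwa [abs_neg, abs_one, one_mul, neg_one_smul, neg_sub] at this
  rw [sub_add_cancel] at h1 h2
  rw [abs_le]
  constructor <;> linarith

/-- The subcritical (and critical) embeddings of `X` into `L^r(Ω)`. -/
theorem exists_eLpNorm_le_normX (hs0 : 0 < s) (hN : 2 * s < (N : ℝ))
    (hΩb : Bornology.IsBounded Ω) {r : ℝ} (hr : 1 ≤ r) (hrq : r ≤ critExp N s) :
    ∃ C : ℝ, 0 < C ∧ ∀ u : X N s Ω,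
      eLpNorm u.1 (ENNReal.ofReal r) (volume.restrict Ω) ≤
        ENNReal.ofReal (C * normX u) := by
  obtain ⟨C, hC, H⟩ := exists_eLpNorm_critExp_le (N := N) hs0 hN
  set D : ℝ≥0∞ := C * volume Ω ^ (1 / r - 1 / critExp N s)
  have hD : D ≠ ∞ := by
    refine ENNReal.mul_ne_top hC (ENNReal.rpow_ne_top_of_nonneg ?_ hΩb.measure_lt_top.ne)
    rw [sub_nonneg]
    exact one_div_le_one_div_of_le (by linarith) hrq
  refine ⟨D.toReal + 1, by positivity, fun u => ?_⟩
  have h1 := eLpNorm_le_eLpNorm_mul_rpow_measure_univ (μ := volume.restrict Ω)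
    (ENNReal.ofReal_le_ofReal hrq) (measurable_coe u).aestronglyMeasurable
  rw [Measure.restrict_apply_univ, ENNReal.toReal_ofReal (by linarith),
    ENNReal.toReal_ofReal (by linarith)] at h1
  have h2 := (eLpNorm_mono_measure _ (Measure.restrict_le_self (s := Ω))).trans
    (H _ (measurable_coe u) (Lp.memLp u.1))
  rw [sqrt_gagliardoEnergy_eq] at h2
  calc _ ≤ _ := h1
    _ ≤ C * ENNReal.ofReal (normX u) * volume Ω ^ (1 / r - 1 / critExp N s) := by gcongr
    _ = D * ENNReal.ofReal (normX u) := by simp only [D]; ring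
    _ ≤ ENNReal.ofReal (D.toReal + 1) * ENNReal.ofReal (normX u) := by
        gcongr
        rw [ENNReal.le_ofReal_iff_toReal_le hD (by positivity)]
        linarith
    _ = _ := by rw [ENNReal.ofReal_mul (by positivity)]

theorem memLp_of_le_critExp (hs0 : 0 < s) (hN : 2 * s < (N : ℝ))
    (hΩb : Bornology.IsBounded Ω) {r : ℝ} (hr : 1 ≤ r) (hrq : r ≤ critExp N s) (u : X N s Ω) :
    MemLp u.1 (ENNReal.ofReal r) (volume.restrict Ω) := by
  obtain ⟨C, -, hC⟩ := exists_eLpNorm_le_normX hs0 hN hΩb hr hrq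
  exact ⟨(measurable_coe u).aestronglyMeasurable, (hC u).trans_lt ENNReal.ofReal_lt_top⟩

/-- A Poincaré inequality: functions in X vanish outside Ω, so the embedding into L²(Ω) controls the
L² norm on the whole space. -/
theorem exists_norm_le_normX (hs0 : 0 < s) (hN : 2 * s < (N : ℝ)) (hΩo : IsOpen Ω)
    (hΩb : Bornology.IsBounded Ω) :
    ∃ C : ℝ, 0 < C ∧ ∀ u : X N s Ω, ‖u.1‖ ≤ C * normX u := by
  obtain ⟨C, hC0, hC⟩ := exists_eLpNorm_le_normX hs0 hN hΩb one_le_two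
    (two_lt_critExp hs0 hN).le
  refine ⟨C, hC0, fun u => ?_⟩
  have h1 : ⇑u.1 =ᵐ[volume]
      Ω.indicator u.1 := by
    filter_upwards [u.2.2] with x hx
    by_cases hxΩ : x ∈ Ω
    · rw [Set.indicator_of_mem hxΩ]
    · rw [Set.indicator_of_notMem hxΩ, hx hxΩ]
  have h2 := hC u
  rw [ENNReal.ofReal_ofNat, ← eLpNorm_indicator_eq_eLpNorm_restrict hΩo.measurableSet,
    ← eLpNorm_congr_ae h1] at h2
  rw [Lp.norm_def]
  exact ENNReal.toReal_le_of_le_ofReal (mul_nonneg hC0.le (normX_nonneg _)) h2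

end Space

/-! ### Compact embedding -/

section Compactness

variable {N : ℕ} {s : ℝ} {Ω : Set (EuclideanSpace ℝ (Fin N))}

/-- The Gagliardo energy is lower semicontinuous for convergence almost everywhere. -/
theorem gagliardoEnergy_le_liminf {v : ℕ → EuclideanSpace ℝ (Fin N) → ℝ}
    {w : EuclideanSpace ℝ (Fin N) → ℝ} (hv : ∀ n, Measurable (v n))
    (h : ∀ᵐ x, Tendsto (fun n => v n x) atTop (𝓝 (w x))) :
    gagliardoEnergy N s w ≤ liminf (fun n => gagliardoEnergy N s (v n)) atTop := by
  set k : ℕ → EuclideanSpace ℝ (Fin N) → EuclideanSpace ℝ (Fin N) → ℝ≥0∞ := fun n x y =>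
    ENNReal.ofReal (|v n x - v n y| ^ 2 / ‖x - y‖ ^ ((N : ℝ) + 2 * s)) with hk
  have hm : ∀ n, Measurable (Function.uncurry (k n)) := fun n =>
    measurable_gagliardo_integrand (s := s) (hv n)
  -- Fatou's lemma is applied twice, first in y and then in x.
  have h1 : ∀ x, ∫⁻ y, liminf (fun n => k n x y) atTop ≤ liminf (fun n => ∫⁻ y, k n x y) atTop :=
    fun x => lintegral_liminf_le (μ := volume) (u := (atTop : Filter ℕ)) (f := fun n => k n x)
      fun n => (hm n).of_uncurry_left
  have h2 : ∫⁻ x, liminf (fun n => ∫⁻ y, k n x y) atTop ≤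
      liminf (fun n => ∫⁻ x, ∫⁻ y, k n x y) atTop :=
    lintegral_liminf_le fun n => (hm n).lintegral_prod_right'
  have hlim : ∀ x y, Tendsto (fun n => v n x) atTop (𝓝 (w x)) →
      Tendsto (fun n => v n y) atTop (𝓝 (w y)) →
      ENNReal.ofReal (|w x - w y| ^ 2 / ‖x - y‖ ^ ((N : ℝ) + 2 * s)) =
        liminf (fun n => k n x y) atTop := fun x y hx hy =>
    (Tendsto.liminf_eq
      (ENNReal.tendsto_ofReal ((((hx.sub hy).abs).pow 2).div_const _))).symm
  have h3 : gagliardoEnergy N s w = ∫⁻ x, ∫⁻ y, liminf (fun n => k n x y) atTop := by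
    unfold gagliardoEnergy
    refine lintegral_congr_ae ?_
    filter_upwards [h] with x hx
    refine lintegral_congr_ae ?_
    filter_upwards [h] with y hy
    exact hlim x y hx hy
  rw [h3]
  exact (lintegral_mono h1).trans h2

/-- The squared error of the cube approximation is at most a constant times h^(2s) K², which tends
to 0 with h. -/
theorem totallyBounded_normX_le (hs0 : 0 < s) (hN : 2 * s < (N : ℝ)) (hΩo : IsOpen Ω)
    (hΩb : Bornology.IsBounded Ω) (K : ℝ) :
    TotallyBounded {x : Lp ℝ 2 (volume : Measure (EuclideanSpace ℝ (Fin N))) |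
      ∃ u : X N s Ω, normX u ≤ K ∧ u.1 = x} := by
  obtain ⟨C, hC0, hC⟩ := exists_norm_le_normX hs0 hN hΩo hΩb
  refine totallyBounded_of_finiteDimensional_approx ?_ fun ε hε => ?_
  · refine isBounded_iff_forall_norm_le.2 ⟨C * K, ?_⟩
    rintro _ ⟨u, hu, rfl⟩
    exact (hC u).trans (mul_le_mul_of_nonneg_left hu hC0.le)
  -- The added 1 keeps D positive, in particular when K = 0.
  set D : ℝ := Real.sqrt N ^ ((N : ℝ) + 2 * s) * K ^ 2 + 1
  have hD : 0 < D := by positivity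
  set h : ℝ := (ε ^ 2 / D) ^ (1 / (2 * s))
  have hh : 0 < h := by positivity
  have hhs : h ^ (2 * s) = ε ^ 2 / D := by
    simp only [h]
    rw [← Real.rpow_mul (by positivity), one_div_mul_cancel (by positivity), Real.rpow_one]
  have hA : (Real.sqrt N * h) ^ ((N : ℝ) + 2 * s) / h ^ N * K ^ 2 ≤ ε ^ 2 := by
    rw [Real.mul_rpow (Real.sqrt_nonneg _) hh.le, Real.rpow_add hh, Real.rpow_natCast, hhs]
    have e : Real.sqrt N ^ ((N : ℝ) + 2 * s) * (h ^ N * (ε ^ 2 / D)) / h ^ N * K ^ 2 =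
        ε ^ 2 * ((D - 1) / D) := by
      simp only [D]
      field_simp
      ring
    rw [e]
    refine mul_le_of_le_one_right (sq_nonneg _) ?_
    rw [div_le_one hD]
    linarith
  obtain ⟨V, hV, H⟩ := exists_finiteDimensional_approx (s := s) hs0 hΩb hh
  refine ⟨V, hV, ?_⟩
  rintro _ ⟨u, hu, rfl⟩
  obtain ⟨v, hv, huv⟩ := H u
  refine ⟨v, hv, ?_⟩
  have h1 : ‖u.1 - v‖ₑ ≤ ENNReal.ofReal ε := by
    refine huv.trans ?_
    rw [gagliardoEnergy_eq, ← ENNReal.ofReal_mul (by positivity)]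
    have e : ENNReal.ofReal ε = ENNReal.ofReal (ε ^ 2) ^ (1 / 2 : ℝ) := by
      rw [ENNReal.ofReal_rpow_of_pos (by positivity), ← Real.sqrt_eq_rpow, Real.sqrt_sq hε.le]
    rw [e]
    refine ENNReal.rpow_le_rpow (ENNReal.ofReal_le_ofReal (le_trans ?_ hA)) (by norm_num)
    have := normX_nonneg u
    gcongr
  rw [← ofReal_norm] at h1
  exact (ENNReal.ofReal_le_ofReal_iff hε.le).1 h1

/-- Bounded sequences of `X` have subsequences that converge almost everywhere and in `L^p(Ω)`,
for `p` subcritical, to an element of `X` that satisfies the same bound. -/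
theorem exists_subseq_tendsto (hs0 : 0 < s) (hN : 2 * s < (N : ℝ)) (hΩo : IsOpen Ω)
    (hΩb : Bornology.IsBounded Ω) {p : ℝ} (hp2 : 2 ≤ p) (hp : p < critExp N s) {K : ℝ}
    {u : ℕ → X N s Ω} (hu : ∀ n, normX (u n) ≤ K) :
    ∃ (v : X N s Ω) (φ : ℕ → ℕ), StrictMono φ ∧ normX v ≤ K ∧
      (∀ᵐ x, Tendsto (fun n => (u (φ n)).1 x) atTop (𝓝 (v.1 x))) ∧
      Tendsto (fun n => eLpNorm (u (φ n) - v).1 (ENNReal.ofReal p) (volume.restrict Ω))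
        atTop (𝓝 0) := by
  have hK : 0 ≤ K := (normX_nonneg _).trans (hu 0)
  have hc := (totallyBounded_normX_le (s := s) hs0 hN hΩo hΩb K).closure
  obtain ⟨w, -, φ, hφ, hw⟩ := (isCompact_iff_totallyBounded_isComplete.2
    ⟨hc, isClosed_closure.isComplete⟩).tendsto_subseq
    (x := fun n => (u n).1) fun n => subset_closure ⟨u n, hu n, rfl⟩
  -- Almost everywhere convergence puts the limit in X: it gives the energy bound by semicontinuity
  -- and the vanishing outside Ω.
  obtain ⟨ψ, hψ, hae⟩ := (tendstoInMeasure_of_tendsto_Lp hw).exists_seq_tendsto_ae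
  have hE : gagliardoEnergy N s w ≤ ENNReal.ofReal (K ^ 2) := by
    refine (gagliardoEnergy_le_liminf (fun n => measurable_coe (u (φ (ψ n)))) hae).trans ?_
    refine (liminf_le_liminf (v := fun _ => ENNReal.ofReal (K ^ 2))
      (Eventually.of_forall fun n => ?_)).trans (by simp)
    rw [gagliardoEnergy_eq]
    have h1 := hu (φ (ψ n))
    have h2 := normX_nonneg (u (φ (ψ n)))
    gcongr
  have hw0 : ∀ᵐ x, x ∉ Ω → w x = 0 := by
    filter_upwards [hae, ae_all_iff.2 fun n => (u n).2.2] with x h1 h2 hx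
    refine tendsto_nhds_unique h1 ?_
    simp only [Function.comp_apply, fun n => h2 n hx]
    exact tendsto_const_nhds
  set v : X N s Ω := ⟨w, hE.trans_lt ENNReal.ofReal_lt_top, hw0⟩
  refine ⟨v, φ ∘ ψ, hφ.comp hψ, ?_, hae, ?_⟩
  · have h1 : ENNReal.ofReal (normX v ^ 2) ≤ ENNReal.ofReal (K ^ 2) := by
      rw [← gagliardoEnergy_eq]; exact hE
    exact abs_le_of_sq_le_sq' ((ENNReal.ofReal_le_ofReal_iff (sq_nonneg K)).1 h1) hK |>.2
  -- L² convergence and boundedness in the critical norm give L^p convergence by interpolation.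
  · obtain ⟨c, d, hc0, hd0, H⟩ := exists_eLpNorm_le_interpolation (μ := volume.restrict Ω) hp2 hp
    obtain ⟨C, hC0, hC⟩ := exists_eLpNorm_le_normX (Ω := Ω) hs0 hN hΩb
      (one_le_two.trans (hp2.trans hp.le)) le_rfl
    have h1 : Tendsto (fun n => ‖(u (φ (ψ n)) - v).1‖ₑ) atTop (𝓝 0) := by
      have h2 : Tendsto (fun n => (u (φ (ψ n)) - v).1) atTop (𝓝 0) := by
        have h3 := (hw.comp hψ.tendsto_atTop).sub_const w
        rw [sub_self] at h3
        exact h3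
      have := h2.enorm
      rwa [enorm_zero] at this
    have hvK : ∀ n, normX (u n - v) ≤ K + normX v := fun n => by
      have h2 := normX_add_le (u n) (-v)
      have h3 : normX (-v) = normX v := by
        rw [← neg_one_smul ℝ v, normX_smul, abs_neg, abs_one, one_mul]
      rw [h3, ← sub_eq_add_neg] at h2
      linarith [hu n]
    have h2 := ENNReal.Tendsto.mul_const (b := ENNReal.ofReal (C * (K + normX v)) ^ d)
      (((ENNReal.continuous_rpow_const (y := c)).tendsto 0).comp h1)
      (Or.inr (ENNReal.rpow_ne_top_of_nonneg hd0 ENNReal.ofReal_ne_top))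
    rw [ENNReal.zero_rpow_of_pos hc0, zero_mul] at h2
    refine tendsto_of_tendsto_of_tendsto_of_le_of_le tendsto_const_nhds h2 (fun _ => zero_le)
      fun n => ?_
    refine (H _ (measurable_coe _).aestronglyMeasurable).trans ?_
    dsimp only [Function.comp_apply]
    gcongr
    · rw [Lp.enorm_def]
      exact eLpNorm_mono_measure _ Measure.restrict_le_self
    · refine (hC _).trans (ENNReal.ofReal_le_ofReal ?_)
      have := hvK (φ (ψ n))
      gcongr

/-- On the bounded set Ω, convergence in L^p implies convergence in L^r for r ≤ p; one subsequence
thus serves both the f and the g integrals. -/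
theorem tendsto_weightedInt (hs0 : 0 < s) (hN : 2 * s < (N : ℝ))
    (hΩb : Bornology.IsBounded Ω) {w : EuclideanSpace ℝ (Fin N) → ℝ}
    (hw : MemLp w ∞ (volume.restrict Ω)) {r p : ℝ} (hr : 1 ≤ r) (hrp : r ≤ p)
    (hp : p ≤ critExp N s) {ι : Type*} {l : Filter ι} {u : ι → X N s Ω} {v : X N s Ω}
    (h : Tendsto (fun i => eLpNorm (u i - v).1 (ENNReal.ofReal p) (volume.restrict Ω))
      l (𝓝 0)) :
    Tendsto (fun i => weightedInt w r (u i)) l (𝓝 (weightedInt w r v)) := by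
  have hmem := fun u : X N s Ω => memLp_of_le_critExp hs0 hN hΩb hr (hrp.trans hp) u
  refine tendsto_integral_weight_mul hw hr (fun i => hmem (u i)) (hmem v) ?_
  have hr0 : 0 < r := by linarith
  have hp0 : 0 < p := by linarith
  have h2 := ENNReal.Tendsto.mul_const (b := volume Ω ^ (1 / r - 1 / p)) h
    (Or.inr (ENNReal.rpow_ne_top_of_nonneg
      (sub_nonneg.2 (one_div_le_one_div_of_le hr0 hrp)) hΩb.measure_lt_top.ne))
  rw [zero_mul] at h2
  refine tendsto_of_tendsto_of_tendsto_of_le_of_le tendsto_const_nhds h2 (fun _ => zero_le)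
    fun i => ?_
  have h3 := eLpNorm_le_eLpNorm_mul_rpow_measure_univ (μ := volume.restrict Ω)
    (ENNReal.ofReal_le_ofReal hrp) (measurable_coe (u i - v)).aestronglyMeasurable
  rw [Measure.restrict_apply_univ, ENNReal.toReal_ofReal hr0.le, ENNReal.toReal_ofReal hp0.le] at h3
  refine le_trans (le_of_eq ?_) h3
  exact eLpNorm_congr_ae (ae_restrict_of_ae (coeFn_sub (u i) v).symm)

end Compactness

/-! ### Tent functions have finite energy -/

section Bumps

variable {N : ℕ} {s : ℝ} {Ω : Set (EuclideanSpace ℝ (Fin N))}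

/-- In polar coordinates the integrand is ρ^(1-2s) near 0, integrable since s < 1, and a multiple of
ρ^(-1-2s) at infinity, integrable since s > 0. -/
theorem lintegral_min_sq_div_rpow_lt_top (hs0 : 0 < s) (hs1 : s < 1) (hN0 : 0 < N) {r : ℝ}
    (hr : 0 < r) :
    ∫⁻ z : EuclideanSpace ℝ (Fin N),
      ENNReal.ofReal (min ‖z‖ r ^ 2 / ‖z‖ ^ ((N : ℝ) + 2 * s)) < ∞ := by
  have : Nonempty (Fin N) := ⟨⟨0, hN0⟩⟩
  have : Nontrivial (EuclideanSpace ℝ (Fin N)) := inferInstance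
  refine Integrable.lintegral_lt_top (f := fun z : EuclideanSpace ℝ (Fin N) =>
    min ‖z‖ r ^ 2 / ‖z‖ ^ ((N : ℝ) + 2 * s)) ?_
  refine (integrable_fun_norm_addHaar volume
    (f := fun ρ : ℝ => min ρ r ^ 2 / ρ ^ ((N : ℝ) + 2 * s))).2 ?_
  rw [finrank_euclideanSpace_fin, ← Set.Ioc_union_Ioi_eq_Ioi hr.le, integrableOn_union]
  have hcast : ((N - 1 : ℕ) : ℝ) = N - 1 := by
    rw [Nat.cast_sub hN0, Nat.cast_one]
  constructor
  · have h1 : IntegrableOn (fun ρ : ℝ => ρ ^ (1 - 2 * s)) (Set.Ioc 0 r) :=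
      (intervalIntegrable_iff_integrableOn_Ioc_of_le hr.le).1
        (intervalIntegral.intervalIntegrable_rpow' (by linarith))
    refine h1.congr_fun (fun ρ hρ => ?_) measurableSet_Ioc
    have hρ0 : 0 < ρ := hρ.1
    simp only [smul_eq_mul]
    rw [min_eq_left hρ.2, ← Real.rpow_natCast ρ (N - 1), hcast, ← Real.rpow_two,
      ← Real.rpow_sub hρ0, ← Real.rpow_add hρ0]
    congr 1
    ring
  · have h1 : IntegrableOn (fun ρ : ℝ => r ^ 2 * ρ ^ (-1 - 2 * s)) (Set.Ioi r) :=
      (integrableOn_Ioi_rpow_of_lt (by linarith) hr).const_mul _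
    refine h1.congr_fun (fun ρ hρ => ?_) measurableSet_Ioi
    have hρ0 : 0 < ρ := hr.trans hρ
    simp only [smul_eq_mul]
    have e : (-1 - 2 * s : ℝ) = ((N : ℝ) - 1) - (N + 2 * s) := by ring
    rw [min_eq_right (le_of_lt hρ), ← Real.rpow_natCast ρ (N - 1), hcast, e, Real.rpow_sub hρ0]
    ring

/-- Lipschitz functions supported in a ball have finite Gagliardo energy. -/
theorem gagliardoEnergy_lt_top_of_lipschitz (hs0 : 0 < s) (hs1 : s < 1) (hN0 : 0 < N) {r : ℝ}
    (hr : 0 < r) {x₀ : EuclideanSpace ℝ (Fin N)} {v : EuclideanSpace ℝ (Fin N) → ℝ}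
    (hv : ∀ x y, |v x - v y| ≤ min ‖x - y‖ r) (hv0 : ∀ x ∉ Metric.ball x₀ r, v x = 0) :
    gagliardoEnergy N s v < ∞ := by
  set m : EuclideanSpace ℝ (Fin N) → ℝ≥0∞ := fun z =>
    ENNReal.ofReal (min ‖z‖ r ^ 2 / ‖z‖ ^ ((N : ℝ) + 2 * s)) with hm
  have hmm : Measurable m := by
    refine ENNReal.measurable_ofReal.comp ?_
    exact ((measurable_norm.min measurable_const).pow_const 2).div (measurable_norm.pow_const _)
  have hsub : Measurable fun q : EuclideanSpace ℝ (Fin N) × EuclideanSpace ℝ (Fin N) =>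
      m (q.1 - q.2) := hmm.comp (measurable_fst.sub measurable_snd)
  have hml : ∀ x, Measurable fun y => m (x - y) := fun x =>
    hmm.comp (measurable_const.sub measurable_id)
  have hmr : ∀ y, Measurable fun x => m (x - y) := fun y =>
    hmm.comp (measurable_id.sub measurable_const)
  set B := Metric.ball x₀ r
  have hB : MeasurableSet B := Metric.isOpen_ball.measurableSet
  have hind : Measurable (B.indicator (1 : EuclideanSpace ℝ (Fin N) → ℝ≥0∞)) :=
    measurable_one.indicator hB
  have hI : ∫⁻ z, m z < ∞ := lintegral_min_sq_div_rpow_lt_top hs0 hs1 hN0 hr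
  -- A pair contributes only if one of its points lies in B; by translation invariance each of the
  -- two terms integrates to |B| ∫ m.
  have hpt : ∀ x y, ENNReal.ofReal (|v x - v y| ^ 2 / ‖x - y‖ ^ ((N : ℝ) + 2 * s)) ≤
      B.indicator 1 x * m (x - y) + B.indicator 1 y * m (x - y) := by
    intro x y
    have h1 : ENNReal.ofReal (|v x - v y| ^ 2 / ‖x - y‖ ^ ((N : ℝ) + 2 * s)) ≤ m (x - y) := by
      refine ENNReal.ofReal_le_ofReal ?_
      have := hv x y
      gcongr
    by_cases hx : x ∈ B
    · rw [Set.indicator_of_mem hx, Pi.one_apply, one_mul]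
      exact h1.trans le_self_add
    by_cases hy : y ∈ B
    · rw [Set.indicator_of_mem hy, Pi.one_apply, one_mul]
      exact h1.trans le_add_self
    · rw [hv0 x hx, hv0 y hy]
      simp
  have e1 : ∫⁻ x, ∫⁻ y, B.indicator 1 x * m (x - y) = volume B * ∫⁻ z, m z := by
    have : ∀ x, ∫⁻ y, B.indicator 1 x * m (x - y) = B.indicator 1 x * ∫⁻ z, m z := fun x => by
      rw [lintegral_const_mul _ (hml x),
        lintegral_sub_left_eq_self]
    rw [lintegral_congr this, lintegral_mul_const _ hind, lintegral_indicator_one hB]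
  have e2 : ∫⁻ x, ∫⁻ y, B.indicator 1 y * m (x - y) = volume B * ∫⁻ z, m z := by
    rw [lintegral_lintegral_swap ((hind.comp measurable_snd).mul hsub).aemeasurable]
    have : ∀ y, ∫⁻ x, B.indicator 1 y * m (x - y) = B.indicator 1 y * ∫⁻ z, m z := fun y => by
      rw [lintegral_const_mul _ (hmr y),
        lintegral_sub_right_eq_self]
    rw [lintegral_congr this, lintegral_mul_const _ hind, lintegral_indicator_one hB]
  have hfin : volume B * ∫⁻ z, m z < ∞ := ENNReal.mul_lt_top measure_ball_lt_top hI
  calc gagliardoEnergy N s v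
      ≤ ∫⁻ x, ∫⁻ y, (B.indicator 1 x * m (x - y) + B.indicator 1 y * m (x - y)) :=
        lintegral_mono fun x => lintegral_mono fun y => hpt x y
    _ = ∫⁻ x, ((∫⁻ y, B.indicator 1 x * m (x - y)) + ∫⁻ y, B.indicator 1 y * m (x - y)) :=
        lintegral_congr fun x => lintegral_add_left ((hml x).const_mul _) _
    _ = (volume B * ∫⁻ z, m z) + volume B * ∫⁻ z, m z := by
        have : Measurable fun q : EuclideanSpace ℝ (Fin N) × EuclideanSpace ℝ (Fin N) =>
            B.indicator (1 : EuclideanSpace ℝ (Fin N) → ℝ≥0∞) q.1 * m (q.1 - q.2) :=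
          (hind.comp measurable_fst).mul hsub
        exact (lintegral_add_left this.lintegral_prod_right' _).trans (congrArg₂ _ e1 e2)
    _ < ∞ := ENNReal.add_lt_top.2 ⟨hfin, hfin⟩

/-- The space `X` contains a tent function supported in any given ball inside `Ω`. -/
theorem exists_tent (hs0 : 0 < s) (hs1 : s < 1) (hN0 : 0 < N) {r : ℝ} (hr : 0 < r)
    {x₀ : EuclideanSpace ℝ (Fin N)} (hΩ : Metric.ball x₀ r ⊆ Ω) :
    ∃ u : X N s Ω, u.1 =ᵐ[volume] fun x => max (r - ‖x - x₀‖) 0 := by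
  set v : EuclideanSpace ℝ (Fin N) → ℝ := fun x => max (r - ‖x - x₀‖) 0
  have hcont : Continuous v :=
    (continuous_const.sub (continuous_id.sub continuous_const).norm).max continuous_const
  have hv0 : ∀ x ∉ Metric.ball x₀ r, v x = 0 := fun x hx => by
    rw [Metric.mem_ball, dist_eq_norm, not_lt] at hx
    exact max_eq_right (by linarith)
  have hcs : HasCompactSupport v := by
    refine HasCompactSupport.of_support_subset_isCompact (isCompact_closedBall x₀ r) fun x hx => ?_
    by_contra hxB
    exact hx (hv0 x fun h => hxB (Metric.ball_subset_closedBall h))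
  have hmem : MemLp v 2 volume := hcont.memLp_of_hasCompactSupport hcs
  have hd : ∀ x y, |v x - v y| ≤ min ‖x - y‖ r := by
    intro x y
    refine le_min ?_ ?_
    · refine (abs_max_sub_max_le_max _ _ _ _).trans ?_
      rw [sub_self, abs_zero, max_eq_left (abs_nonneg _), sub_sub_sub_cancel_left]
      refine (abs_norm_sub_norm_le _ _).trans ?_
      rw [sub_sub_sub_cancel_right, norm_sub_rev]
    · have hb : ∀ x, 0 ≤ v x ∧ v x ≤ r := fun x =>
        ⟨le_max_right _ _, max_le (by linarith [norm_nonneg (x - x₀)]) hr.le⟩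
      rw [abs_le]
      constructor <;> linarith [(hb x).1, (hb x).2, (hb y).1, (hb y).2]
  have hE := gagliardoEnergy_lt_top_of_lipschitz hs0 hs1 hN0 hr hd hv0
  refine ⟨⟨hmem.toLp v, ?_, ?_⟩, hmem.coeFn_toLp⟩
  · rwa [gagliardoEnergy_congr hmem.coeFn_toLp]
  · filter_upwards [hmem.coeFn_toLp] with x hx hxΩ
    rw [hx, hv0 x fun h => hxΩ (hΩ h)]

end Bumps

/-! ### The cone C⁺ -/

section Cone

variable {N : ℕ} {s : ℝ} {Ω : Set (EuclideanSpace ℝ (Fin N))}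

theorem weightedInt_smul (w : EuclideanSpace ℝ (Fin N) → ℝ) (q : ℝ) (c : ℝ) (u : X N s Ω) :
    weightedInt w q (c • u) = |c| ^ q * weightedInt w q u := by
  unfold weightedInt
  rw [← integral_const_mul]
  refine integral_congr_ae ?_
  filter_upwards [ae_restrict_of_ae (coeFn_smul c u)] with x hx
  rw [hx, Pi.smul_apply, smul_eq_mul, abs_mul, Real.mul_rpow (abs_nonneg _) (abs_nonneg _)]
  ring

theorem not_ae_eq_zero_of_weightedInt_pos {w : EuclideanSpace ℝ (Fin N) → ℝ} {q : ℝ} (hq : 0 < q)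
    {u : X N s Ω} (hu : 0 < weightedInt w q u) : ¬ u.1 =ᵐ[volume.restrict Ω] 0 := by
  intro h
  refine hu.ne' ?_
  unfold weightedInt
  rw [← integral_zero (EuclideanSpace ℝ (Fin N)) ℝ]
  refine integral_congr_ae ?_
  filter_upwards [h] with x hx
  rw [hx, Pi.zero_apply, abs_zero, Real.zero_rpow hq.ne', mul_zero]

theorem weightedInt_pos_of_not_ae_eq_zero (hs0 : 0 < s) (hN : 2 * s < (N : ℝ)) (hΩo : IsOpen Ω)
    (hΩb : Bornology.IsBounded Ω) {f : EuclideanSpace ℝ (Fin N) → ℝ}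
    (hf : MemLp f ∞ (volume.restrict Ω)) (hfpos : ∀ x ∈ Ω, 0 < f x) {r : ℝ} (hr : 1 ≤ r)
    (hrq : r ≤ critExp N s) {u : X N s Ω} (hu : ¬ u.1 =ᵐ[volume.restrict Ω] 0) :
    0 < weightedInt f r u := by
  have hmem := memLp_of_le_critExp hs0 hN hΩb hr hrq u
  unfold weightedInt
  rw [setIntegral_pos_iff_support_of_nonneg_ae _ (integrable_weight_mul hf hr hmem)]
  · rw [pos_iff_ne_zero]
    intro h
    refine hu ?_
    rw [EventuallyEq, ae_restrict_iff' hΩo.measurableSet]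
    filter_upwards [measure_eq_zero_iff_ae_notMem.1 h] with x hx hxΩ
    by_contra hne
    refine hx ⟨?_, hxΩ⟩
    exact (mul_pos (hfpos x hxΩ) (Real.rpow_pos_of_pos (abs_pos.2 hne) _)).ne'
  · filter_upwards [ae_restrict_mem hΩo.measurableSet] with x hx
    exact mul_nonneg (hfpos x hx).le (by positivity)

theorem normX_pos_of_not_ae_eq_zero (hs0 : 0 < s) (hN : 2 * s < (N : ℝ))
    (hΩb : Bornology.IsBounded Ω) {u : X N s Ω} (hu : ¬ u.1 =ᵐ[volume.restrict Ω] 0) :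
    0 < normX u := by
  refine lt_of_le_of_ne (normX_nonneg u) fun h => hu ?_
  obtain ⟨C, hC0, hC⟩ := exists_eLpNorm_le_normX (Ω := Ω) hs0 hN hΩb one_le_two
    (two_lt_critExp hs0 hN).le
  have h1 := hC u
  rw [← h, mul_zero, ENNReal.ofReal_zero, nonpos_iff_eq_zero, ENNReal.ofReal_ofNat] at h1
  exact (eLpNorm_eq_zero_iff (measurable_coe u).aestronglyMeasurable two_ne_zero).1 h1

/-- Arbitrarily concentrated unit vectors of `X` in the cone `C⁺`. -/
theorem exists_unit_mem_Cplus (hs0 : 0 < s) (hs1 : s < 1) (hN : 2 * s < (N : ℝ))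
    (hΩo : IsOpen Ω) (hΩb : Bornology.IsBounded Ω) {g : EuclideanSpace ℝ (Fin N) → ℝ}
    (hgc : ContinuousOn g Ω) (hgb : MemLp g ∞ (volume.restrict Ω)) {p : ℝ} (hp1 : 1 ≤ p)
    (hp : p ≤ critExp N s) {x₀ : EuclideanSpace ℝ (Fin N)} (hx₀ : x₀ ∈ Ω) (hg : 0 < g x₀)
    {δ : ℝ} (hδ : 0 < δ) :
    ∃ u ∈ Cplus N s Ω g p, normX u = 1 ∧ ∀ᵐ x, x ∉ Metric.ball x₀ δ → u.1 x = 0 := by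
  have hN0 : 0 < N := by
    have : (0 : ℝ) < N := by linarith
    exact_mod_cast this
  have hp0 : 0 < p := by linarith
  have hnhds : {x | x ∈ Ω ∧ 0 < g x} ∈ 𝓝 x₀ :=
    inter_mem (hΩo.mem_nhds hx₀) ((hgc.continuousAt (hΩo.mem_nhds hx₀)).eventually_const_lt hg)
  obtain ⟨ρ, hρ, hball⟩ := Metric.mem_nhds_iff.1 hnhds
  -- Small enough for g to be positive on the ball and for the support to lie within δ of x₀.
  set r := min ρ δ
  have hr : 0 < r := lt_min hρ hδ
  have hB : Metric.ball x₀ r ⊆ {x | x ∈ Ω ∧ 0 < g x} :=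
    (Metric.ball_subset_ball (min_le_left _ _)).trans hball
  obtain ⟨v, hv⟩ := exists_tent (s := s) hs0 hs1 hN0 hr (fun x hx => (hB hx).1)
  have hvB : ∀ x ∈ Metric.ball x₀ r, 0 < max (r - ‖x - x₀‖) 0 := fun x hx => by
    rw [Metric.mem_ball, dist_eq_norm] at hx
    exact lt_max_of_lt_left (by linarith)
  have hvB' : ∀ x ∉ Metric.ball x₀ r, max (r - ‖x - x₀‖) 0 = 0 := fun x hx => by
    rw [Metric.mem_ball, dist_eq_norm, not_lt] at hx
    exact max_eq_right (by linarith)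
  have hmem := memLp_of_le_critExp hs0 hN hΩb hp1 hp v
  have hpos : 0 < weightedInt g p v := by
    unfold weightedInt
    rw [setIntegral_pos_iff_support_of_nonneg_ae _ (integrable_weight_mul hgb hp1 hmem)]
    · refine (Metric.measure_ball_pos volume x₀ hr).trans_le (measure_mono_ae ?_)
      filter_upwards [hv] with x hx hxB
      refine ⟨?_, (hB hxB).1⟩
      rw [Function.mem_support, hx]
      exact (mul_pos (hB hxB).2 (Real.rpow_pos_of_pos (abs_pos.2 (hvB x hxB).ne') _)).ne'
    · filter_upwards [ae_restrict_of_ae hv] with x hx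
      rw [Pi.zero_apply, hx]
      by_cases hxB : x ∈ Metric.ball x₀ r
      · exact mul_nonneg (hB hxB).2.le (by positivity)
      · rw [hvB' x hxB, abs_zero, Real.zero_rpow hp0.ne', mul_zero]
  have hn : 0 < normX v :=
    normX_pos_of_not_ae_eq_zero hs0 hN hΩb (not_ae_eq_zero_of_weightedInt_pos hp0 hpos)
  refine ⟨(normX v)⁻¹ • v, ?_, ?_, ?_⟩
  · change 0 < weightedInt g p _
    rw [weightedInt_smul]
    positivity
  · rw [normX_smul, abs_of_pos (inv_pos.2 hn), inv_mul_cancel₀ hn.ne']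
  · filter_upwards [hv, coeFn_smul (normX v)⁻¹ v] with x h1 h2 hx
    rw [h2, Pi.smul_apply, h1, hvB' x fun h => hx (Metric.ball_subset_ball (min_le_right _ _) h),
      smul_zero]

end Cone

/-! ### The Rayleigh quotient on the cone -/

/-- The standing assumptions on the data of the fractional Kirchhoff problem. -/
structure IsKirchhoffData (N : ℕ) (s : ℝ) (Ω : Set (EuclideanSpace ℝ (Fin N)))
    (f g : EuclideanSpace ℝ (Fin N) → ℝ) (a b θ γ p : ℝ) : Prop where
  s_pos : 0 < s
  s_lt_one : s < 1
  two_mul_s_lt : 2 * s < (N : ℝ)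
  isOpen : IsOpen Ω
  isBounded : Bornology.IsBounded Ω
  memLp_f : MemLp f ∞ (volume.restrict Ω)
  f_pos : ∀ x ∈ Ω, 0 < f x
  continuousOn_g : ContinuousOn g Ω
  memLp_g : MemLp g ∞ (volume.restrict Ω)
  exists_g_pos : ∃ x ∈ Ω, 0 < g x
  a_nonneg : 0 ≤ a
  b_pos : 0 < b
  one_lt_θ : 1 < θ
  two_mul_θ_lt : 2 * θ < p
  p_lt : p < critExp N s
  one_lt_γ : 1 < γ
  γ_lt : γ < 2 * θ
  a_eq_zero_or : a = 0 ∨ γ < 2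

/-- The fiber quotient of `u`, whose maximum over `t > 0` is `λ_{a,b}(u)`. -/
noncomputable def fiberAt {N : ℕ} {s : ℝ} {Ω : Set (EuclideanSpace ℝ (Fin N))}
    (f g : EuclideanSpace ℝ (Fin N) → ℝ) (a b θ γ p : ℝ) (u : X N s Ω) (t : ℝ) : ℝ :=
  fiberQuotient (a * normX u ^ 2) (b * normX u ^ (2 * θ)) (weightedInt f γ u) (weightedInt g p u)
    θ γ p t

namespace IsKirchhoffData

variable {N : ℕ} {s : ℝ} {Ω : Set (EuclideanSpace ℝ (Fin N))}
  {f g : EuclideanSpace ℝ (Fin N) → ℝ} {a b θ γ p : ℝ}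

theorem γ_lt_p (h : IsKirchhoffData N s Ω f g a b θ γ p) : γ < p :=
  h.γ_lt.trans h.two_mul_θ_lt

theorem two_lt_p (h : IsKirchhoffData N s Ω f g a b θ γ p) : 2 < p := by
  linarith [h.one_lt_θ, h.two_mul_θ_lt]

theorem a_mul_nonneg (h : IsKirchhoffData N s Ω f g a b θ γ p) (r : ℝ) :
    0 ≤ (2 - γ) * (a * r ^ 2) := by
  rcases h.a_eq_zero_or with h0 | h0
  · simp [h0]
  · exact mul_nonneg (by linarith) (mul_nonneg h.a_nonneg (sq_nonneg _))

theorem a_mul_eq_zero_or (h : IsKirchhoffData N s Ω f g a b θ γ p) (r : ℝ) :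
    a * r ^ 2 = 0 ∨ γ < 2 :=
  h.a_eq_zero_or.imp_left fun h0 => by rw [h0, zero_mul]

theorem normX_pos (h : IsKirchhoffData N s Ω f g a b θ γ p) {u : X N s Ω}
    (hu : u ∈ Cplus N s Ω g p) : 0 < normX u :=
  normX_pos_of_not_ae_eq_zero h.s_pos h.two_mul_s_lt h.isBounded
    (not_ae_eq_zero_of_weightedInt_pos (by linarith [h.two_lt_p]) hu)

theorem weightedInt_f_pos (h : IsKirchhoffData N s Ω f g a b θ γ p) {u : X N s Ω}
    (hu : u ∈ Cplus N s Ω g p) : 0 < weightedInt f γ u :=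
  weightedInt_pos_of_not_ae_eq_zero h.s_pos h.two_mul_s_lt h.isOpen h.isBounded h.memLp_f h.f_pos
    h.one_lt_γ.le (h.γ_lt_p.trans h.p_lt).le
    (not_ae_eq_zero_of_weightedInt_pos (by linarith [h.two_lt_p]) hu)

theorem b_mul_pos (h : IsKirchhoffData N s Ω f g a b θ γ p) {u : X N s Ω}
    (hu : u ∈ Cplus N s Ω g p) : 0 < b * normX u ^ (2 * θ) :=
  mul_pos h.b_pos (Real.rpow_pos_of_pos (h.normX_pos hu) _)

theorem solvesSystem_iff (h : IsKirchhoffData N s Ω f g a b θ γ p) {u : X N s Ω}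
    (hu : u ∈ Cplus N s Ω g p) {t l : ℝ} :
    SolvesSystem f g a b θ γ p u t l ↔ 0 < t ∧
      fiberSlope (a * normX u ^ 2) (b * normX u ^ (2 * θ)) θ γ p t =
        (p - γ) * weightedInt g p u ∧ l = fiberAt f g a b θ γ p u t := by
  unfold SolvesSystem
  refine and_congr_right fun ht => ?_
  rw [fiberAt, ← scalar_system_iff (h.weightedInt_f_pos hu) ht, normX_smul, weightedInt_smul,
    abs_of_pos ht, Real.mul_rpow ht.le (normX_nonneg u)]
  refine and_congr (Eq.congr_left ?_) (Eq.congr_left ?_) <;> ring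

theorem existsUnique_solution (h : IsKirchhoffData N s Ω f g a b θ γ p) {u : X N s Ω}
    (hu : u ∈ Cplus N s Ω g p) : ∃! q : ℝ × ℝ, SolvesSystem f g a b θ γ p u q.1 q.2 := by
  obtain ⟨t, ht, hslope⟩ := exists_fiberSlope_eq (h.a_mul_nonneg (normX u)) (h.b_mul_pos hu)
    h.one_lt_θ h.γ_lt h.two_mul_θ_lt (K := (p - γ) * weightedInt g p u)
    (mul_pos (by linarith [h.γ_lt_p]) hu)
  refine ⟨(t, fiberAt f g a b θ γ p u t), (h.solvesSystem_iff hu).2 ⟨ht, hslope, rfl⟩, ?_⟩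
  rintro ⟨τ, l⟩ hq
  obtain ⟨hτ, hτs, hl⟩ := (h.solvesSystem_iff hu).1 hq
  have : τ = t := (fiberSlope_strictAntiOn (h.a_mul_nonneg (normX u)) (h.b_mul_pos hu)
    h.one_lt_θ h.γ_lt h.two_mul_θ_lt).injOn hτ ht (hτs.trans hslope.symm)
  dsimp only at hl
  rw [hl, this]

theorem lambdaAB_eq (h : IsKirchhoffData N s Ω f g a b θ γ p) {u : X N s Ω}
    (hu : u ∈ Cplus N s Ω g p) {t l : ℝ} (hl : SolvesSystem f g a b θ γ p u t l) :
    lambdaAB f g a b θ γ p u = l := by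
  have hex : ∃ q : ℝ × ℝ, SolvesSystem f g a b θ γ p u q.1 q.2 := ⟨(t, l), hl⟩
  rw [lambdaAB, dif_pos hex]
  exact congrArg Prod.snd ((h.existsUnique_solution hu).unique hex.choose_spec
    (y₂ := (t, l)) hl)

theorem exists_lambdaAB_eq_fiberAt (h : IsKirchhoffData N s Ω f g a b θ γ p) {u : X N s Ω}
    (hu : u ∈ Cplus N s Ω g p) :
    ∃ t, 0 < t ∧ fiberSlope (a * normX u ^ 2) (b * normX u ^ (2 * θ)) θ γ p t =
      (p - γ) * weightedInt g p u ∧ lambdaAB f g a b θ γ p u = fiberAt f g a b θ γ p u t := by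
  obtain ⟨⟨t, l⟩, hq, -⟩ := h.existsUnique_solution hu
  obtain ⟨ht, hs, hl⟩ := (h.solvesSystem_iff hu).1 hq
  exact ⟨t, ht, hs, (h.lambdaAB_eq hu hq).trans hl⟩

/-- This is the max characterization of λ: a bound on λ yields one inequality for every τ, with no
reference to the maximum point. -/
theorem fiberAt_le_lambdaAB (h : IsKirchhoffData N s Ω f g a b θ γ p) {u : X N s Ω}
    (hu : u ∈ Cplus N s Ω g p) {τ : ℝ} (hτ : 0 < τ) :
    fiberAt f g a b θ γ p u τ ≤ lambdaAB f g a b θ γ p u := by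
  obtain ⟨t, ht, hs, hl⟩ := h.exists_lambdaAB_eq_fiberAt hu
  rw [hl]
  exact fiberQuotient_le (mul_nonneg h.a_nonneg (sq_nonneg _)) (h.a_mul_eq_zero_or _)
    (h.b_mul_pos hu) (h.weightedInt_f_pos hu) h.one_lt_θ h.γ_lt h.two_mul_θ_lt ht hτ hs

theorem lambdaAB_pos (h : IsKirchhoffData N s Ω f g a b θ γ p) {u : X N s Ω}
    (hu : u ∈ Cplus N s Ω g p) : 0 < lambdaAB f g a b θ γ p u := by
  obtain ⟨t, ht, hs, hl⟩ := h.exists_lambdaAB_eq_fiberAt hu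
  rw [hl]
  exact fiberQuotient_pos (mul_nonneg h.a_nonneg (sq_nonneg _))
    (h.b_mul_pos hu) (h.weightedInt_f_pos hu) h.one_lt_θ h.γ_lt h.two_mul_θ_lt ht hs

theorem smul_mem_Cplus {u : X N s Ω} (hu : u ∈ Cplus N s Ω g p) {c : ℝ} (hc : c ≠ 0) :
    c • u ∈ Cplus N s Ω g p := by
  change 0 < weightedInt g p _
  rw [weightedInt_smul]
  exact mul_pos (Real.rpow_pos_of_pos (abs_pos.2 hc) _) hu

/-- A solution (t, l) for cu is a solution (|c|t, l) for u. -/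
theorem lambdaAB_smul (h : IsKirchhoffData N s Ω f g a b θ γ p) {u : X N s Ω}
    (hu : u ∈ Cplus N s Ω g p) {c : ℝ} (hc : c ≠ 0) :
    lambdaAB f g a b θ γ p (c • u) = lambdaAB f g a b θ γ p u := by
  have hcu := smul_mem_Cplus hu hc
  obtain ⟨⟨t, l⟩, ⟨ht, h1, h2⟩, -⟩ := h.existsUnique_solution hcu
  rw [h.lambdaAB_eq hcu ⟨ht, h1, h2⟩]
  have hc' : 0 < |c| := abs_pos.2 hc
  have ht' : 0 < t := ht
  refine (h.lambdaAB_eq hu (t := |c| * t) ⟨mul_pos hc' ht', ?_, ?_⟩).symm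
  all_goals
    simp only [normX_smul, weightedInt_smul, abs_mul, abs_abs, abs_of_pos ht'] at h1 h2 ⊢
    rw [Real.mul_rpow hc'.le ht'.le, Real.mul_rpow hc'.le ht'.le, mul_comm (|c|) t]
  · rw [← h1, mul_assoc t]; ring
  · rw [← h2, mul_assoc t]; ring

/-- The filter is pulled back along `normX` because the topology that X inherits is that of L². -/
theorem tendsto_lambdaAB (h : IsKirchhoffData N s Ω f g a b θ γ p) {u : X N s Ω}
    (hu : u ∈ Cplus N s Ω g p) :
    Tendsto (lambdaAB f g a b θ γ p)
      (comap (fun v : X N s Ω => normX (v - u)) (𝓝 0) ⊓ 𝓟 (Cplus N s Ω g p))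
      (𝓝 (lambdaAB f g a b θ γ p u)) := by
  set l := comap (fun v : X N s Ω => normX (v - u)) (𝓝 0) ⊓ 𝓟 (Cplus N s Ω g p)
  have hmem : ∀ᶠ v in l, v ∈ Cplus N s Ω g p := mem_inf_of_right (mem_principal_self _)
  have hd : Tendsto (fun v : X N s Ω => normX (v - u)) l (𝓝 0) := tendsto_comap.mono_left inf_le_left
  have hn : Tendsto (fun v : X N s Ω => normX v) l (𝓝 (normX u)) := by
    rw [tendsto_iff_norm_sub_tendsto_zero]
    exact squeeze_zero (fun _ => norm_nonneg _) (fun v => abs_normX_sub_le v u) hd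
  obtain ⟨C, hC0, hC⟩ := exists_eLpNorm_le_normX (Ω := Ω) h.s_pos h.two_mul_s_lt h.isBounded
    (one_le_two.trans h.two_lt_p.le) h.p_lt.le
  have hLp : Tendsto (fun v : X N s Ω =>
      eLpNorm (v - u).1 (ENNReal.ofReal p) (volume.restrict Ω)) l (𝓝 0) := by
    have h1 := ENNReal.tendsto_ofReal (hd.const_mul C)
    rw [mul_zero, ENNReal.ofReal_zero] at h1
    exact tendsto_of_tendsto_of_tendsto_of_le_of_le tendsto_const_nhds h1 (fun _ => zero_le)
      fun v => hC _
  have hF := tendsto_weightedInt h.s_pos h.two_mul_s_lt h.isBounded h.memLp_f h.one_lt_γ.le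
    h.γ_lt_p.le h.p_lt.le hLp
  have hG := tendsto_weightedInt h.s_pos h.two_mul_s_lt h.isBounded h.memLp_g
    (one_le_two.trans h.two_lt_p.le) le_rfl h.p_lt.le hLp
  choose! t ht using fun (v : X N s Ω) (hv : v ∈ Cplus N s Ω g p) =>
    h.exists_lambdaAB_eq_fiberAt hv
  obtain ⟨hu0, hus, hul⟩ := ht u hu
  rw [hul]
  have key := tendsto_fiberQuotient_of_fiberSlope_eq (ti := t) (h.a_mul_nonneg (normX u))
    (h.b_mul_pos hu) (h.weightedInt_f_pos hu) h.one_lt_θ h.γ_lt h.two_mul_θ_lt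
    ((hn.pow 2).const_mul a)
    ((hn.rpow_const (p := 2 * θ) (Or.inl (h.normX_pos hu).ne')).const_mul b) hF hG
    (Eventually.of_forall fun v => h.a_mul_nonneg (normX v)) hu0
    (hmem.mono fun v hv => (ht v hv).1) hus (hmem.mono fun v hv => (ht v hv).2.1)
  refine key.congr' ?_
  filter_upwards [hmem] with v hv
  exact (ht v hv).2.2.symm

theorem fiberAt_mul_of_normX_eq_one (h : IsKirchhoffData N s Ω f g a b θ γ p) {u : X N s Ω}
    (hu : u ∈ Cplus N s Ω g p) (hn : normX u = 1) (τ : ℝ) :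
    fiberAt f g a b θ γ p u τ * weightedInt f γ u =
      a * τ ^ (2 - γ) + b * τ ^ (2 * θ - γ) - weightedInt g p u * τ ^ (p - γ) := by
  rw [fiberAt, fiberQuotient, div_mul_cancel₀ _ (h.weightedInt_f_pos hu).ne', hn, one_pow,
    Real.one_rpow, mul_one, mul_one]

/-- Along unit vectors whose supports shrink to x₀ the limit vanishes almost everywhere, so both
weighted integrals tend to 0; an upper bound M for λ would give b ≤ M F + G at τ = 1, hence b ≤ 0.
-/
theorem not_bddAbove_lambdaAB (h : IsKirchhoffData N s Ω f g a b θ γ p) :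
    ¬ BddAbove (lambdaAB f g a b θ γ p '' Cplus N s Ω g p) := by
  rintro ⟨M, hM⟩
  obtain ⟨x₀, hx₀, hg⟩ := h.exists_g_pos
  have hN0 : (0 : ℝ) < N := by linarith [h.s_pos, h.two_mul_s_lt]
  have : Nonempty (Fin N) := ⟨⟨0, by exact_mod_cast hN0⟩⟩
  have : Nontrivial (EuclideanSpace ℝ (Fin N)) := inferInstance
  have hp1 : 1 ≤ p := one_le_two.trans h.two_lt_p.le
  choose u hu hun hu0 using fun n : ℕ => exists_unit_mem_Cplus h.s_pos h.s_lt_one h.two_mul_s_lt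
    h.isOpen h.isBounded h.continuousOn_g h.memLp_g hp1 h.p_lt.le hx₀ hg
    (δ := 1 / ((n : ℝ) + 1)) Nat.one_div_pos_of_nat
  obtain ⟨v, φ, hφ, -, hae, hLp⟩ := exists_subseq_tendsto h.s_pos h.two_mul_s_lt h.isOpen
    h.isBounded h.two_lt_p.le h.p_lt (fun n => (hun n).le)
  have hv : v.1 =ᵐ[volume] 0 := by
    have hne : ∀ᵐ x : EuclideanSpace ℝ (Fin N), x ≠ x₀ :=
      compl_mem_ae_iff.2 (measure_singleton x₀)
    filter_upwards [hae, ae_all_iff.2 hu0, hne] with x h1 h2 hx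
    refine tendsto_nhds_unique h1 (tendsto_const_nhds.congr' ?_)
    have h3 : ∀ᶠ n : ℕ in atTop, 1 / ((n : ℝ) + 1) < dist x x₀ :=
      tendsto_one_div_add_atTop_nhds_zero_nat.eventually_lt_const (dist_pos.2 hx)
    filter_upwards [hφ.tendsto_atTop.eventually h3] with n hn
    exact (h2 _ fun hB => (Metric.mem_ball.1 hB).not_gt hn).symm
  have hzero : ∀ (w : EuclideanSpace ℝ (Fin N) → ℝ) (q : ℝ), 0 < q → weightedInt w q v = 0 := by
    intro w q hq
    unfold weightedInt
    rw [← integral_zero (EuclideanSpace ℝ (Fin N)) ℝ]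
    refine integral_congr_ae ?_
    filter_upwards [ae_restrict_of_ae hv] with x hx
    rw [hx, Pi.zero_apply, abs_zero, Real.zero_rpow hq.ne', mul_zero]
  have hF := tendsto_weightedInt h.s_pos h.two_mul_s_lt h.isBounded h.memLp_f h.one_lt_γ.le
    h.γ_lt_p.le h.p_lt.le hLp
  have hG := tendsto_weightedInt h.s_pos h.two_mul_s_lt h.isBounded h.memLp_g hp1 le_rfl
    h.p_lt.le hLp
  rw [hzero f γ (by linarith [h.one_lt_γ])] at hF
  rw [hzero g p (by linarith)] at hG
  have hsum := (hF.mul_const M).add hG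
  rw [zero_mul, zero_add] at hsum
  have hb : ∀ n, b ≤ weightedInt f γ (u (φ n)) * M + weightedInt g p (u (φ n)) := by
    intro n
    have h1 := h.fiberAt_mul_of_normX_eq_one (hu (φ n)) (hun (φ n)) 1
    simp only [Real.one_rpow, mul_one] at h1
    have h2 := (h.fiberAt_le_lambdaAB (hu (φ n)) one_pos).trans (hM ⟨_, hu (φ n), rfl⟩)
    have h3 := mul_le_mul_of_nonneg_right h2 (h.weightedInt_f_pos (hu (φ n))).le
    linarith [h.a_nonneg]
  exact absurd (ge_of_tendsto' hsum hb) (not_le.2 h.b_pos)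

theorem exists_lambdaAB_eq_lambdaStar (h : IsKirchhoffData N s Ω f g a b θ γ p) :
    ∃ u ∈ Cplus N s Ω g p,
      lambdaAB f g a b θ γ p u = lambdaStar N s Ω f g a b θ γ p := by
  have hp1 : 1 ≤ p := one_le_two.trans h.two_lt_p.le
  obtain ⟨x₀, hx₀, hg⟩ := h.exists_g_pos
  obtain ⟨w, hw, -⟩ := exists_unit_mem_Cplus h.s_pos h.s_lt_one h.two_mul_s_lt
    h.isOpen h.isBounded h.continuousOn_g h.memLp_g hp1 h.p_lt.le hx₀ hg one_pos
  set S := lambdaAB f g a b θ γ p '' Cplus N s Ω g p with hS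
  have hSne : S.Nonempty := ⟨_, w, hw, rfl⟩
  have hSpos : ∀ r ∈ S, 0 ≤ r := by
    rintro _ ⟨u, hu, rfl⟩
    exact (h.lambdaAB_pos hu).le
  have hSb : BddBelow S := ⟨0, hSpos⟩
  set m := lambdaStar N s Ω f g a b θ γ p
  have hm0 : 0 ≤ m := le_csInf hSne hSpos
  have hmin : ∀ n : ℕ, ∃ u ∈ Cplus N s Ω g p, normX u = 1 ∧
      lambdaAB f g a b θ γ p u < m + 1 / ((n : ℝ) + 1) := by
    intro n
    obtain ⟨_, ⟨u, hu, rfl⟩, hlt⟩ := exists_lt_of_csInf_lt hSne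
      (show sInf S < m + 1 / ((n : ℝ) + 1) from lt_add_of_pos_right _ Nat.one_div_pos_of_nat)
    have hn := h.normX_pos hu
    refine ⟨(normX u)⁻¹ • u, smul_mem_Cplus hu (inv_pos.2 hn).ne', ?_, ?_⟩
    · rw [normX_smul, abs_of_pos (inv_pos.2 hn), inv_mul_cancel₀ hn.ne']
    · rwa [h.lambdaAB_smul hu (inv_pos.2 hn).ne']
  choose u hu hun hlt using hmin
  obtain ⟨v, φ, hφ, hv1, -, hLp⟩ := exists_subseq_tendsto h.s_pos h.two_mul_s_lt h.isOpen
    h.isBounded h.two_lt_p.le h.p_lt (fun n => (hun n).le)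
  have hF := tendsto_weightedInt h.s_pos h.two_mul_s_lt h.isBounded h.memLp_f h.one_lt_γ.le
    h.γ_lt_p.le h.p_lt.le hLp
  have hG := tendsto_weightedInt h.s_pos h.two_mul_s_lt h.isBounded h.memLp_g hp1 le_rfl
    h.p_lt.le hLp
  -- The coefficients a and b come from the unit norms of the sequence; the norm of v itself has not
  -- entered yet.
  have hlim : ∀ τ, 0 < τ →
      a * τ ^ (2 - γ) + b * τ ^ (2 * θ - γ) - weightedInt g p v * τ ^ (p - γ) ≤
        m * weightedInt f γ v := by
    intro τ hτ
    have hr : Tendsto (fun n => (m + 1 / ((φ n : ℝ) + 1)) * weightedInt f γ (u (φ n))) atTop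
        (𝓝 ((m + 0) * weightedInt f γ v)) :=
      ((tendsto_one_div_add_atTop_nhds_zero_nat.comp hφ.tendsto_atTop).const_add m).mul hF
    rw [add_zero] at hr
    refine le_of_tendsto_of_tendsto' (tendsto_const_nhds.sub (hG.mul_const _)) hr fun n => ?_
    rw [← h.fiberAt_mul_of_normX_eq_one (hu (φ n)) (hun (φ n)) τ]
    exact mul_le_mul_of_nonneg_right ((h.fiberAt_le_lambdaAB (hu (φ n)) hτ).trans (hlt (φ n)).le)
      (h.weightedInt_f_pos (hu (φ n))).le
  have hG0 : 0 ≤ weightedInt g p v := ge_of_tendsto' hG fun n => (hu (φ n)).le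
  have hv : v ∈ Cplus N s Ω g p := by
    refine lt_of_le_of_ne hG0 fun hG' => ?_
    have hF0 : 0 ≤ weightedInt f γ v :=
      ge_of_tendsto' hF fun n => (h.weightedInt_f_pos (hu (φ n))).le
    -- With τ^(2θ-γ) = R the b-term equals m F(v) + 1, which violates `hlim` when G(v) = 0.
    set R := (m * weightedInt f γ v + 1) / b
    have hR : 0 < R := div_pos (by positivity) h.b_pos
    have hk : 0 < 2 * θ - γ := by linarith [h.γ_lt]
    have h1 := hlim (R ^ (1 / (2 * θ - γ))) (by positivity)
    rw [← hG', zero_mul, sub_zero, ← Real.rpow_mul hR.le, ← Real.rpow_mul hR.le,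
      one_div_mul_cancel hk.ne', Real.rpow_one, mul_div_cancel₀ _ h.b_pos.ne'] at h1
    have h2 : 0 ≤ a * R ^ (1 / (2 * θ - γ) * (2 - γ)) := mul_nonneg h.a_nonneg (by positivity)
    linarith
  refine ⟨v, hv, le_antisymm ?_ (csInf_le hSb ⟨v, hv, rfl⟩)⟩
  obtain ⟨t, ht, -, hl⟩ := h.exists_lambdaAB_eq_fiberAt hv
  rw [hl, fiberAt, fiberQuotient, div_le_iff₀ (h.weightedInt_f_pos hv)]
  -- Since ‖v‖ ≤ 1, the numerator for v is at most the one with coefficients a and b.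
  refine le_trans ?_ (hlim t ht)
  have hn0 := normX_nonneg v
  have h1 : normX v ^ 2 ≤ 1 := pow_le_one₀ hn0 hv1
  have h2 : normX v ^ (2 * θ) ≤ 1 := Real.rpow_le_one hn0 hv1 (by linarith [h.one_lt_θ])
  have ha := h.a_nonneg
  have hb := h.b_pos.le
  gcongr
  · exact mul_le_of_le_one_right ha h1
  · exact mul_le_of_le_one_right hb h2

end IsKirchhoffData

end FracKirchhoff

/-! ### Assembly of the theorem -/

theorem mainTheorem4 (N : ℕ) (s : ℝ) (hs0 : 0 < s) (hs1 : s < 1) (hN : 2 * s < (N : ℝ))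
    (Ω : Set (EuclideanSpace ℝ (Fin N))) (hΩo : IsOpen Ω) (hΩb : Bornology.IsBounded Ω)
    (f g : EuclideanSpace ℝ (Fin N) → ℝ)
    (hfc : ContinuousOn f Ω) (hfb : MemLp f ∞ (volume.restrict Ω)) (hfpos : ∀ x ∈ Ω, 0 < f x)
    (hgc : ContinuousOn g Ω) (hgb : MemLp g ∞ (volume.restrict Ω)) (hgpos : ∃ x ∈ Ω, 0 < g x)
    (a b θ γ p : ℝ) (ha : 0 ≤ a) (hb : 0 < b) (hθ : 1 < θ)
    (hθp : 2 * θ < p) (hp : p < 2 * (N : ℝ) / ((N : ℝ) - 2 * s))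
    (hnondeg : a ≠ 0 → 1 < γ ∧ γ < 2) (hdeg : a = 0 → 2 < γ ∧ γ < 2 * θ) :
    -- the system has exactly one solution for each `u` in `C⁺`
    (∀ u ∈ FracKirchhoff.Cplus N s Ω g p,
      ∃! q : ℝ × ℝ, FracKirchhoff.SolvesSystem f g a b θ γ p u q.1 q.2) ∧
    -- continuity on `C⁺` for the norm of `X`
    (∀ u ∈ FracKirchhoff.Cplus N s Ω g p, ∀ ε > 0, ∃ δ > 0,
      ∀ v ∈ FracKirchhoff.Cplus N s Ω g p, FracKirchhoff.normX (v - u) < δ →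
        |FracKirchhoff.lambdaAB f g a b θ γ p v - FracKirchhoff.lambdaAB f g a b θ γ p u| < ε) ∧
    -- homogeneity of degree zero
    (∀ u ∈ FracKirchhoff.Cplus N s Ω g p, ∀ c : ℝ, c ≠ 0 →
      c • u ∈ FracKirchhoff.Cplus N s Ω g p ∧
      FracKirchhoff.lambdaAB f g a b θ γ p (c • u) = FracKirchhoff.lambdaAB f g a b θ γ p u) ∧
    -- unboundedness from above
    ¬ BddAbove (FracKirchhoff.lambdaAB f g a b θ γ p '' FracKirchhoff.Cplus N s Ω g p) ∧
    -- the extremal value is positive and attained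
    0 < FracKirchhoff.lambdaStar N s Ω f g a b θ γ p ∧
    ∃ u ∈ FracKirchhoff.Cplus N s Ω g p,
      FracKirchhoff.lambdaAB f g a b θ γ p u = FracKirchhoff.lambdaStar N s Ω f g a b θ γ p := by
  -- Both regimes share these bounds: 1 < γ < 2θ, and the a-term is either absent or has γ < 2.
  have hγ : 1 < γ ∧ γ < 2 * θ ∧ (a = 0 ∨ γ < 2) := by
    by_cases h0 : a = 0
    · exact ⟨by linarith [(hdeg h0).1], (hdeg h0).2, Or.inl h0⟩
    · exact ⟨(hnondeg h0).1, by linarith [(hnondeg h0).2], Or.inr (hnondeg h0).2⟩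
  have h : FracKirchhoff.IsKirchhoffData N s Ω f g a b θ γ p :=
    { s_pos := hs0
      s_lt_one := hs1
      two_mul_s_lt := hN
      isOpen := hΩo
      isBounded := hΩb
      memLp_f := hfb
      f_pos := hfpos
      continuousOn_g := hgc
      memLp_g := hgb
      exists_g_pos := hgpos
      a_nonneg := ha
      b_pos := hb
      one_lt_θ := hθ
      two_mul_θ_lt := hθp
      p_lt := hp
      one_lt_γ := hγ.1
      γ_lt := hγ.2.1
      a_eq_zero_or := hγ.2.2 }
  obtain ⟨u, hu, hmin⟩ := h.exists_lambdaAB_eq_lambdaStar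
  refine ⟨fun u hu => h.existsUnique_solution hu, fun u hu ε hε => ?_, fun u hu c hc =>
    ⟨FracKirchhoff.IsKirchhoffData.smul_mem_Cplus hu hc, h.lambdaAB_smul hu hc⟩,
    h.not_bddAbove_lambdaAB, hmin ▸ h.lambdaAB_pos hu, u, hu, hmin⟩
  have hev := Metric.tendsto_nhds.1 (h.tendsto_lambdaAB hu) ε hε
  rw [Filter.eventually_inf_principal, Filter.eventually_comap, Metric.eventually_nhds_iff] at hev
  obtain ⟨δ, hδ, H⟩ := hev
  refine ⟨δ, hδ, fun v hv hvu => ?_⟩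
  rw [← Real.dist_eq]
  refine H ?_ v rfl hv
  rwa [Real.dist_eq, sub_zero, abs_of_nonneg (FracKirchhoff.normX_nonneg _)]
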